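/- Let $k$ be a field, $q\in k^\times$ with $q\neq1$, let $e\in\{2,3,\dots\}\cup\{\infty\}$ be the multiplicative order of $q$, and represent residues by $\{1,\dots,e\}$ (by $\mathbb Z$ if $e=\infty$) with the usual order of integers. Let $n\ge2$, $W=S_n$ with simple transpositions $s_r=(r,r+1)$, $r\in\mathbb I=\{1,\dots,n-1\}$, and length $\ell$. For $J\subseteq K\subseteq\mathbb I$ let $W_J=\langle s_r:r\in J\rangle$ and let $D^K_{\emptyset,J}$ be the set of minimal length representatives of $W_K/W_J$. *Hecke and Schur algebras.* Let $H$ be the $k$-algebra with generators $T_r$ ($r\in\mathbb I$), $X_j^{\pm1}$ ($1\le j\le n$) and relations: $(T_r-q)(T_r+1)=0$, the braid relations, the $X_j^{\pm1}$ commute and $X_jX_j^{-1}=X_j^{-1}X_j=1$, $T_rX_j=X_jT_r$ for $j\ne r,r+1$, and $T_rX_rT_r=qX_{r+1}$. Let $T_w$ ($w\in W$) be the product of the $T_r$ along a reduced expression. Let $\sharp$ be the algebra endomorphism $T_r\mapsto q-1-T_r$, $X_j\mapsto X_j^{-1}$, and $v_J=\sum_{w\in W_J}T_w$. Fix a sequence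 of residues $\mathbf i=(i_1,\dots,i_n)$, with orbit $W\mathbf i$ under $(w\cdot u)_j=u_{w^{-1}(j)}$, and let $\widehat H$ be the completion of $H$ at the powers of the two-sided ideal generated by the symmetric Laurent polynomials in $X_1,\dots,X_n$ that vanish at $(q^{i_1},\dots,q^{i_n})$. The completed twisted Schur algebra is $\widehat S=\mathrm{End}_{\widehat H}\big(\bigoplus_{J\subseteq\mathbb I}v_J^\sharp\widehat H\big)$ (right modules). For $J\subseteq K$, $\mathbf b^1_{K,J}$ denotes its element that sends $v_J^\sharp$ to $\sum_{w\in W_KW_J}T_w^\sharp\in v_K^\sharp\widehat H$ and vanishes on the summands other than that of $J$. *Representation.* $\widehat H$ acts on $\widehat P=\bigoplus_{u\in W\mathbf i}k[[X_1-q^{u_1},\dots,X_n-q^{u_n}]]e_u$ as follows: $X_j$ acts by multiplication, $W$ permutes variables and idempotents by $w(fe_u)=w(f)e_{w\cdot u}$, and $(T_r+1)f=\frac{qX_{r+1}-X_r}{X_{r+1}-X_r}(f-s_rf)$; elements of $\widehat H$ act by continuity. For $J\subseteq\mathbb I$ let $U_J$ be the set of $u\in W\mathbf i$ with $u_r\le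 u_{r+1}$ for all $r\in J$. For $u\in U_J$ put $I_u=\{r\in J:u_r=u_{r+1}\}$ and let $\widehat R_{+,u}\subset\widehat P$ be the image of the $W_{I_u}$-invariants of $k[[X_1-q^{u_1},\dots,X_n-q^{u_n}]]$ under $g\mapsto\sum_{w\in D^J_{\emptyset,I_u}}w(g)e_{w\cdot u}$. The twisted completed faithful representation of $\widehat S$ is $\bigoplus_{J}\bigoplus_{u\in U_J}\widehat R_{+,u}\,\overline v^{(J)}$; if $\varphi\in\widehat S$ satisfies $\varphi(v_J^\sharp)=\sum_Kh_Kv_J^\sharp$ with $h_Kv_J^\sharp\in v_K^\sharp\widehat H$, $h_K\in\widehat H$, then $\widehat{\overline\rho}(\varphi)(f\overline v^{(J)})=\sum_K(h_Kf)\overline v^{(K)}$. **Statement.** Let $K=\mathbb I$, $a\in\mathbb I$, $J=\mathbb I\setminus\{a\}$. Let $u_J\in U_J$, and let $u_K$ be the weakly increasing sequence in $W\mathbf i$. For a residue $c$ let $d_c$ be the number of entries $c$ in $u_K$, and let $a_c$, $b_c$ be the numbers of entries $c$ of $u_J$ in the positions $1,\dots,a$ and $a+1,\dots,n$ respectively.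 Let $\sigma$ be the element of minimal length among the $w\in W$ with $w\cdot u_J=u_K$. Put $$\theta_{l,k}=\frac{qX_l-X_k}{X_l-X_k},\qquad \pitchfork^{(d_c)}_{(a_c,b_c)}=\sum_{w\in D^{K'}_{\emptyset,J'}}w,$$ where $W_{K'}$ is the Young subgroup of type $(d_1,d_2,\dots)$ and $W_{J'}$ the Young subgroup of type $(a_1,b_1,a_2,b_2,\dots)$ (residues in increasing order). Then $\mathbf b^1_{K,J}$ exists and is unique, and for every $f\in\widehat R_{+,u_J}$ the element $\widehat{\overline\rho}(\mathbf b^1_{K,J})(f\overline v^{(J)})$ lies in the twisted completed faithful representation and satisfies $$e_{u_K}\,\widehat{\overline\rho}(\mathbf b^1_{K,J})\,f\,\overline v^{(J)}=e_{u_K}\,\pitchfork^{(d_c)}_{(a_c,b_c)}\;\sigma\Big(\prod_{k=a+1}^{n}\prod_{l=1}^{a}\theta_{l,k}\;f\Big)\overline v^{(K)}.$$ This is an equality in the field of fractions of the power series ring at $u_K$; in particular the components in the other $\overline v^{(L)}$, $L\ne K$, at $e_{u_K}$ vanish. -/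

import Mathlib

namespace AffineSchur

noncomputable section

/-! ### Permutations, lengths and parabolic subgroups -/

/-- The simple transposition exchanging the neighbouring positions `r` and `r + 1`. -/
def s {m : ℕ} (r : Fin m) : Equiv.Perm (Fin (m + 1)) := Equiv.swap r.castSucc r.succ

/-- The words in the simple transpositions whose product is `w`. -/
def wordsOf {m : ℕ} (w : Equiv.Perm (Fin (m + 1))) : Set (List (Fin m)) :=
  {l | (l.map s).prod = w}

/-- The Coxeter length: the least number of simple transpositions with product `w`. -/
def len {m : ℕ} (w : Equiv.Perm (Fin (m + 1))) : ℕ := sInf (List.length '' wordsOf w)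

theorem wordsOf_nonempty {m : ℕ} (w : Equiv.Perm (Fin (m + 1))) : (wordsOf w).Nonempty := by
  have h : w ∈ Submonoid.closure
      (Set.range fun i : Fin m ↦ Equiv.swap i.castSucc i.succ) := by
    rw [Equiv.Perm.mclosure_swap_castSucc_succ]; trivial
  obtain ⟨l, hl, hw⟩ := Submonoid.exists_list_of_mem_closure h
  clear h
  induction l generalizing w with
  | nil => exact ⟨[], by simpa [wordsOf] using hw⟩
  | cons x l ih =>
    obtain ⟨t, ht⟩ := ih (l.prod) (fun y hy => hl y (List.mem_cons_of_mem _ hy)) rfl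
    obtain ⟨r, hr⟩ := hl x List.mem_cons_self
    refine ⟨r :: t, ?_⟩
    have ht' : (t.map s).prod = l.prod := ht
    change ((r :: t).map s).prod = w
    rw [List.map_cons, List.prod_cons, ht', ← hw, List.prod_cons, ← hr]
    rfl

theorem exists_reducedWord {m : ℕ} (w : Equiv.Perm (Fin (m + 1))) :
    ∃ l : List (Fin m), (l.map s).prod = w ∧ l.length = len w := by
  obtain ⟨l, hl, h⟩ := Nat.sInf_mem ((wordsOf_nonempty w).image List.length)
  exact ⟨l, hl, h⟩

/-- A chosen reduced expression of `w`. -/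
def reducedWord {m : ℕ} (w : Equiv.Perm (Fin (m + 1))) : List (Fin m) :=
  (exists_reducedWord w).choose

/-- The standard parabolic subgroup `W_J` generated by the simple transpositions in `J`. -/
def parabolic {m : ℕ} (J : Finset (Fin m)) : Subgroup (Equiv.Perm (Fin (m + 1))) :=
  Subgroup.closure (s '' (J : Set (Fin m)))

open Classical in
/-- The elements of `W_K` of minimal length in their coset `w W_J` (for `J ⊆ K`: the minimal length
representatives of `W_K / W_J`). -/
def cosetReps {m : ℕ} (K J : Finset (Fin m)) : Finset (Equiv.Perm (Fin (m + 1))) :=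
  Finset.univ.filter fun w => w ∈ parabolic K ∧ ∀ v ∈ parabolic J, len w ≤ len (w * v)

open Classical in
/-- The elements of `W_K W_J` (for `J ⊆ K` or `K ⊆ J` this is the larger one of the two groups). -/
def doubleCosetOne {m : ℕ} (K J : Finset (Fin m)) : Finset (Equiv.Perm (Fin (m + 1))) :=
  Finset.univ.filter fun w => ∃ x ∈ parabolic K, ∃ y ∈ parabolic J, w = x * y

open Classical in
/-- The set of simple transpositions of the Young subgroup `S_{t₁} × S_{t₂} × ⋯`, where
`t = (t₁, t₂, …)`: the positions `r`, `r + 1` (counted from `1`) lie in the same block unless `r`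
is one of the partial sums `t₁ + ⋯ + t_j`. -/
def ofType {m : ℕ} (t : List ℕ) : Finset (Fin m) :=
  Finset.univ.filter fun r => ∀ j, (t.take j).sum ≠ (r : ℕ) + 1

/-! ### Residue sequences -/

/-- Representatives of the exponents `c` of the powers `q ^ c`: the integers `1, …, e` if `q` has
finite order `e`, and all integers otherwise. They are ordered as integers. -/
abbrev Residue {k : Type*} [Field k] (q : kˣ) : Type :=
  {c : ℤ // orderOf q ≠ 0 → 1 ≤ c ∧ c ≤ orderOf q}

theorem Residue.zpow_injective {k : Type*} [Field k] (q : kˣ) :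
    Function.Injective fun c : Residue q => q ^ (c : ℤ) := by
  rintro ⟨c, hc⟩ ⟨d, hd⟩ h
  have h' : q ^ c = q ^ d := h
  rw [zpow_eq_zpow_iff_modEq] at h'
  apply Subtype.ext
  change c = d
  by_cases h0 : orderOf q = 0
  · rw [h0] at h'
    simpa [Int.modEq_zero_iff] using h'
  · have h1 := hc h0
    have h2 := hd h0
    have h3 := (Int.modEq_iff_dvd.mp h')
    obtain ⟨t, ht⟩ := h3
    have : t = 0 := by
      by_contra ht0
      rcases lt_or_gt_of_ne ht0 with h | h
      · nlinarith
      · nlinarith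
    subst this
    linarith

/-- The orbit of the residue sequence `i` under permutations of the positions. -/
abbrev Orb {k : Type*} [Field k] {q : kˣ} {m : ℕ} (i : Fin (m + 1) → Residue q) : Type :=
  {u : Fin (m + 1) → Residue q // ∃ w : Equiv.Perm (Fin (m + 1)), u = i ∘ w}

section

variable {k : Type*} [Field k] {q : kˣ} {m : ℕ} {i : Fin (m + 1) → Residue q}

/-- The left action `(w • u)_j = u_{w⁻¹ j}` on sequences in the orbit. -/
instance : MulAction (Equiv.Perm (Fin (m + 1))) (Orb i) where
  smul w u := ⟨u.1 ∘ (w⁻¹ : Equiv.Perm (Fin (m + 1))), by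
    obtain ⟨v, hv⟩ := u.2
    exact ⟨v * w⁻¹, by rw [hv]; rfl⟩⟩
  one_smul u := Subtype.ext rfl
  mul_smul w v u := by
    apply Subtype.ext
    change u.1 ∘ ((w * v)⁻¹ : Equiv.Perm _) = (u.1 ∘ (v⁻¹ : Equiv.Perm _)) ∘ (w⁻¹ : Equiv.Perm _)
    rw [mul_inv_rev]; rfl

theorem smul_apply (w : Equiv.Perm (Fin (m + 1))) (u : Orb i) (j : Fin (m + 1)) :
    (w • u).1 j = u.1 (w⁻¹ j) := rfl

instance : Finite (Orb i) := by
  refine Finite.of_surjective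
    (fun w : Equiv.Perm (Fin (m + 1)) => (⟨i ∘ w, w, rfl⟩ : Orb i)) ?_
  rintro ⟨u, w, rfl⟩
  exact ⟨w, rfl⟩

instance : Fintype (Orb i) := Fintype.ofFinite _

/-- The sequences in the orbit which are weakly increasing on every block of positions of `J`,
representing the `W_J`-orbits. -/
def U (J : Finset (Fin m)) : Set (Orb i) := {u | ∀ r ∈ J, u.1 r.castSucc ≤ u.1 r.succ}

/-- The simple transpositions in `J` which stabilise `u`. For `u ∈ U J` they generate
the stabiliser of `u` in `W_J`. -/
def stab (J : Finset (Fin m)) (u : Orb i) : Finset (Fin m) :=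
  J.filter fun r => u.1 r.castSucc = u.1 r.succ

end
/-! ### The affine Hecke algebra -/

/-- Generators of the affine Hecke algebra. -/
inductive Gen (m : ℕ) : Type
  | T (r : Fin m) : Gen m
  | X (j : Fin (m + 1)) : Gen m
  | Xinv (j : Fin (m + 1)) : Gen m

section

variable {k : Type*} [Field k] (q : kˣ) (m : ℕ)

/-- The generator `T_r` in the free algebra. -/
abbrev fT {m : ℕ} (r : Fin m) : FreeAlgebra k (Gen m) := FreeAlgebra.ι k (Gen.T r)

/-- The generator `X_j` in the free algebra. -/
abbrev fX {m : ℕ} (j : Fin (m + 1)) : FreeAlgebra k (Gen m) := FreeAlgebra.ι k (Gen.X j)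

/-- The generator `X_j⁻¹` in the free algebra. -/
abbrev fXinv {m : ℕ} (j : Fin (m + 1)) : FreeAlgebra k (Gen m) := FreeAlgebra.ι k (Gen.Xinv j)

/-- The defining relations (Bernstein presentation) of the affine Hecke algebra of `GL_{m+1}`. -/
inductive Rel : FreeAlgebra k (Gen m) → FreeAlgebra k (Gen m) → Prop
  | quad (r : Fin m) :
      Rel ((fT r - algebraMap k _ (q : k)) * (fT r + 1)) 0
  | comm (r t : Fin m) (h : (r : ℕ) + 1 < t) : Rel (fT r * fT t) (fT t * fT r)
  | braid (r t : Fin m) (h : (r : ℕ) + 1 = t) : Rel (fT r * fT t * fT r) (fT t * fT r * fT t)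
  | X_mul_inv (j : Fin (m + 1)) : Rel (fX j * fXinv j) 1
  | inv_mul_X (j : Fin (m + 1)) : Rel (fXinv j * fX j) 1
  | X_comm (j l : Fin (m + 1)) : Rel (fX j * fX l) (fX l * fX j)
  | T_X (r : Fin m) (j : Fin (m + 1)) (h₁ : j ≠ r.castSucc) (h₂ : j ≠ r.succ) :
      Rel (fT r * fX j) (fX j * fT r)
  | T_X_T (r : Fin m) :
      Rel (fT r * fX r.castSucc * fT r) (algebraMap k _ (q : k) * fX r.succ)

/-- The affine Hecke algebra of `GL_{m+1}` with parameter `q`. -/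
abbrev Hecke : Type _ := RingQuot (Rel q m)

variable {m}

/-- The element `T_r`. -/
def hT (r : Fin m) : Hecke q m := RingQuot.mkAlgHom k (Rel q m) (fT r)

/-- The element `X_j`. -/
def hX (j : Fin (m + 1)) : Hecke q m := RingQuot.mkAlgHom k (Rel q m) (fX j)

/-- The element `X_j⁻¹`. -/
def hXinv (j : Fin (m + 1)) : Hecke q m := RingQuot.mkAlgHom k (Rel q m) (fXinv j)

theorem hT_quad (r : Fin m) :
    hT q r * hT q r = algebraMap k _ (q - 1 : k) * hT q r + algebraMap k _ (q : k) := by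
  have h := RingQuot.mkAlgHom_rel k (Rel.quad (q := q) r)
  simp only [map_mul, map_sub, map_add, map_one, map_zero, AlgHom.commutes] at h
  change (hT q r - algebraMap k _ (q : k)) * (hT q r + 1) = 0 at h
  rw [map_sub, map_one, sub_mul, one_mul]
  rw [sub_mul, mul_add, mul_add, mul_one, mul_one] at h
  rw [← sub_eq_zero, ← h]
  abel

theorem hT_comm (r t : Fin m) (h : (r : ℕ) + 1 < t) :
    hT q r * hT q t = hT q t * hT q r := by
  simpa [hT] using RingQuot.mkAlgHom_rel k (Rel.comm (q := q) r t h)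

theorem hT_braid (r t : Fin m) (h : (r : ℕ) + 1 = t) :
    hT q r * hT q t * hT q r = hT q t * hT q r * hT q t := by
  simpa [hT] using RingQuot.mkAlgHom_rel k (Rel.braid (q := q) r t h)

theorem hX_mul_inv (j : Fin (m + 1)) : hX q j * hXinv q j = 1 := by
  simpa [hX, hXinv] using RingQuot.mkAlgHom_rel k (Rel.X_mul_inv (q := q) j)

theorem hX_inv_mul (j : Fin (m + 1)) : hXinv q j * hX q j = 1 := by
  simpa [hX, hXinv] using RingQuot.mkAlgHom_rel k (Rel.inv_mul_X (q := q) j)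

theorem hX_comm (j l : Fin (m + 1)) : hX q j * hX q l = hX q l * hX q j := by
  simpa [hX] using RingQuot.mkAlgHom_rel k (Rel.X_comm (q := q) j l)

theorem hT_X (r : Fin m) (j : Fin (m + 1)) (h₁ : j ≠ r.castSucc) (h₂ : j ≠ r.succ) :
    hT q r * hX q j = hX q j * hT q r := by
  simpa [hX, hT] using RingQuot.mkAlgHom_rel k (Rel.T_X (q := q) r j h₁ h₂)

theorem hT_X_T (r : Fin m) :
    hT q r * hX q r.castSucc * hT q r = algebraMap k _ (q : k) * hX q r.succ := by
  simpa [hX, hT] using RingQuot.mkAlgHom_rel k (Rel.T_X_T (q := q) r)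

/-- The element `X_j` as a unit. -/
def uX (j : Fin (m + 1)) : (Hecke q m)ˣ := ⟨hX q j, hXinv q j, hX_mul_inv q j, hX_inv_mul q j⟩

/-- The images of the generators under the involution: `T_r ↦ q - 1 - T_r`, `X_j ↦ X_j⁻¹`. -/
def hashGen : Gen m → Hecke q m
  | Gen.T r => algebraMap k _ (q - 1 : k) - hT q r
  | Gen.X j => hXinv q j
  | Gen.Xinv j => hX q j

theorem quad_aux {A : Type*} [Ring A] [Algebra k A] (c d : k) (a : A) (hcd : c = d - 1)
    (ha : a * a = algebraMap k A c * a + algebraMap k A d) :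
    (algebraMap k A c - a - algebraMap k A d) * (algebraMap k A c - a + 1) = 0 := by
  subst hcd
  simp only [Algebra.algebraMap_eq_smul_one, sub_mul, mul_sub, mul_add, smul_mul_assoc,
    mul_smul_comm, one_mul, mul_one] at ha ⊢
  rw [ha]
  module

theorem braid_aux {A : Type*} [Ring A] [Algebra k A] (c d : k) (a b : A)
    (ha : a * a = algebraMap k A c * a + algebraMap k A d)
    (hb : b * b = algebraMap k A c * b + algebraMap k A d) (h : a * b * a = b * a * b) :
    (algebraMap k A c - a) * (algebraMap k A c - b) * (algebraMap k A c - a) =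
      (algebraMap k A c - b) * (algebraMap k A c - a) * (algebraMap k A c - b) := by
  simp only [Algebra.algebraMap_eq_smul_one, sub_mul, mul_sub, smul_mul_assoc,
    mul_smul_comm, one_mul, mul_one] at ha hb ⊢
  rw [h, ha, hb]
  module

theorem T_X_T_aux {A : Type*} [Ring A] [Algebra k A] (c : k) (d : kˣ) (a x x' z z' : A)
    (ha : a * a = algebraMap k A c * a + algebraMap k A d)
    (h : a * x * a = algebraMap k A d * z) (hx : x' * x = 1) (hz : z * z' = 1) :
    (algebraMap k A c - a) * x' * (algebraMap k A c - a) = algebraMap k A d * z' := by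
  have e1 : (algebraMap k A c - a) * a = - algebraMap k A d := by rw [sub_mul, ha]; abel
  set b := algebraMap k A c - a
  have e2 : b * x' * b * z = algebraMap k A d := by
    have hu : IsUnit (algebraMap k A d) := RingHom.isUnit_map (algebraMap k A) d.isUnit
    refine hu.mul_left_cancel ?_
    calc algebraMap k A d * (b * x' * b * z) = b * x' * b * (algebraMap k A d * z) := by
          rw [Algebra.commutes, Algebra.commutes (d : k) z]; simp only [mul_assoc]
      _ = b * x' * (b * a) * x * a := by rw [← h]; simp only [mul_assoc]
      _ = - (b * x' * (algebraMap k A d * (x * a))) := by rw [e1]; simp [mul_assoc]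
      _ = - (b * (x' * x) * a * algebraMap k A d) := by
          rw [Algebra.commutes]; simp only [mul_assoc]
      _ = _ := by rw [hx, mul_one, e1]; simp
  calc b * x' * b = b * x' * b * z * z' := by rw [mul_assoc _ z, hz, mul_one]
    _ = _ := by rw [e2]

theorem hash_rel {x y : FreeAlgebra k (Gen m)} (h : Rel q m x y) :
    FreeAlgebra.lift k (hashGen q) x = FreeAlgebra.lift k (hashGen q) y := by
  set c : Hecke q m := algebraMap k _ (q - 1 : k) with hc
  have cc : ∀ x, c * x = x * c := fun x => Algebra.commutes _ x
  have inv_comm : ∀ j l : Fin (m + 1), hXinv q j * hXinv q l = hXinv q l * hXinv q j := by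
    intro j l
    have h1 : Commute (uX q j : Hecke q m) (uX q l) := hX_comm q j l
    exact (h1.units_inv_left).units_inv_right
  cases h with
  | quad r =>
    have h1 := hT_quad q r
    simp only [map_mul, map_sub (FreeAlgebra.lift k (hashGen q)),
      map_add (FreeAlgebra.lift k (hashGen q)), map_one (FreeAlgebra.lift k (hashGen q)),
      map_zero, FreeAlgebra.lift_ι_apply, hashGen, AlgHom.commutes]
    exact quad_aux (q - 1 : k) q (hT q r) rfl h1
  | comm r t h =>
    have h1 := hT_comm q r t h
    simp only [map_mul, FreeAlgebra.lift_ι_apply, hashGen]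
    rw [← hc, sub_mul, sub_mul, mul_sub, mul_sub, mul_sub, mul_sub, h1, cc (hT q r), cc (hT q t)]
    abel
  | braid r t h =>
    simp only [map_mul, FreeAlgebra.lift_ι_apply, hashGen]
    exact braid_aux (q - 1 : k) q _ _ (hT_quad q r) (hT_quad q t) (hT_braid q r t h)
  | X_mul_inv j => simpa [hashGen] using hX_inv_mul q j
  | inv_mul_X j => simpa [hashGen] using hX_mul_inv q j
  | X_comm j l => simpa [hashGen] using inv_comm j l
  | T_X r j h₁ h₂ =>
    have h1 : Commute (hT q r) (uX q j : Hecke q m) := hT_X q r j h₁ h₂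
    have h2 : hT q r * hXinv q j = hXinv q j * hT q r := h1.units_inv_right
    simp only [map_mul, FreeAlgebra.lift_ι_apply, hashGen]
    rw [← hc, sub_mul, mul_sub, h2, cc]
  | T_X_T r =>
    simp only [map_mul, FreeAlgebra.lift_ι_apply, hashGen, AlgHom.commutes]
    exact T_X_T_aux (q - 1 : k) q _ _ _ _ _ (hT_quad q r) (hT_X_T q r) (hX_inv_mul q _)
      (hX_mul_inv q _)

/-- The involution `♯` of the affine Hecke algebra, an algebra homomorphism with
`T_r ↦ q - 1 - T_r = -q T_r⁻¹` and `X_j ↦ X_j⁻¹`. -/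
def hash : Hecke q m →ₐ[k] Hecke q m :=
  RingQuot.liftAlgHom k ⟨FreeAlgebra.lift k (hashGen q), fun _ _ h => hash_rel q h⟩

/-- The standard basis element `T_w` of the finite Hecke algebra, a product of generators along a
reduced expression of `w`. -/
def Tw (w : Equiv.Perm (Fin (m + 1))) : Hecke q m := ((reducedWord w).map (hT q)).prod

open Classical in
/-- The element `v_J^♯`, where `v_J = ∑_{w ∈ W_J} T_w`. -/
def vHash (J : Finset (Fin m)) : Hecke q m :=
  ∑ w ∈ Finset.univ.filter (fun w => w ∈ parabolic J), hash q (Tw q w)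

end

/-! ### The completed affine Hecke algebra -/

section

variable {k : Type*} [Field k] {q : kˣ} {m : ℕ} (i : Fin (m + 1) → Residue q)

variable (q) in
/-- The Laurent monomial `X₁^{α₁} ⋯ X_n^{α_n}` in the affine Hecke algebra. -/
def laurentMonomial (α : Fin (m + 1) → ℤ) : Hecke q m :=
  ((List.ofFn fun j => uX q j ^ α j).prod : (Hecke q m)ˣ)

/-- The kernel of the central character `X_j ↦ q ^ (i_j)` on the symmetric Laurent polynomials. -/
def centralKernel : Set (Hecke q m) :=
  {x | ∃ p : (Fin (m + 1) → ℤ) →₀ k,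
    (∀ (w : Equiv.Perm (Fin (m + 1))) (α : Fin (m + 1) → ℤ), p (α ∘ w) = p α) ∧
    (p.sum fun α c => c * ∏ j, (((q ^ (i j : ℤ)) ^ α j : kˣ) : k)) = 0 ∧
    x = p.sum fun α c => c • laurentMonomial q α}

/-- The two-sided ideal of the affine Hecke algebra generated by the kernel of the central
character. -/
def idealI : TwoSidedIdeal (Hecke q m) := TwoSidedIdeal.span (centralKernel i)

/-- The `r`-th power of the ideal `idealI i`. -/
def idealPow (r : ℕ) : TwoSidedIdeal (Hecke q m) :=
  TwoSidedIdeal.span {x | ∃ y : Fin r → Hecke q m, (∀ j, y j ∈ idealI i) ∧ x = (List.ofFn y).prod}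

/-- The quotient of the affine Hecke algebra by the `r`-th power of the ideal. -/
abbrev Quo (r : ℕ) : Type _ := (idealPow i r).ringCon.Quotient

/-- The quotient map. -/
abbrev toQuo (r : ℕ) : Hecke q m →ₐ[k] Quo i r := (idealPow i r).ringCon.mkₐ k

/-- The completed affine Hecke algebra: the inverse limit of the quotients by the powers of the
ideal, as the algebra of compatible families. -/
def hatSubalgebra : Subalgebra k (∀ r, Quo i r) where
  carrier := {x | ∀ r t, r ≤ t → ∃ h : Hecke q m, toQuo i r h = x r ∧ toQuo i t h = x t}
  mul_mem' := by
    intro x y hx hy r t hrt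
    obtain ⟨g, hg⟩ := hx r t hrt
    obtain ⟨h, hh⟩ := hy r t hrt
    exact ⟨g * h, by rw [map_mul, hg.1, hh.1]; rfl, by rw [map_mul, hg.2, hh.2]; rfl⟩
  add_mem' := by
    intro x y hx hy r t hrt
    obtain ⟨g, hg⟩ := hx r t hrt
    obtain ⟨h, hh⟩ := hy r t hrt
    exact ⟨g + h, by rw [map_add, hg.1, hh.1]; rfl, by rw [map_add, hg.2, hh.2]; rfl⟩
  algebraMap_mem' := fun c r t _ =>
    ⟨algebraMap k _ c, AlgHom.commutes _ c, AlgHom.commutes _ c⟩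

/-- The completed affine Hecke algebra. -/
abbrev HeckeHat : Type _ := hatSubalgebra i

/-- The canonical map from the affine Hecke algebra to its completion. -/
def toHat : Hecke q m →ₐ[k] HeckeHat i :=
  (AlgHom.pi fun r => toQuo i r).codRestrict (hatSubalgebra i)
    fun h _ _ _ => ⟨h, rfl, rfl⟩

/-- An element of the affine Hecke algebra which agrees with `x` modulo the `r`-th power of the
ideal. -/
def approx (r : ℕ) (x : HeckeHat i) : Hecke q m := (x.2 r r le_rfl).choose

theorem toQuo_approx (r : ℕ) (x : HeckeHat i) : toQuo i r (approx i r x) = x.1 r :=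
  (x.2 r r le_rfl).choose_spec.1

end

/-! ### Divided differences of power series -/

/-- The exponent `β` with the entries at `a` and `b` replaced by `p` and `q`. -/
def updTwo {σ : Type*} [DecidableEq σ] (a b : σ) (β : σ →₀ ℕ) (p q : ℕ) : σ →₀ ℕ :=
  (β.update a p).update b q

theorem coeff_rename_swap {σ k : Type*} [DecidableEq σ] [Finite σ] [Field k] (a b : σ) (hab : a ≠ b)
    (h : MvPowerSeries σ k) (β : σ →₀ ℕ) (p q : ℕ) :
    MvPowerSeries.coeff (updTwo a b β p q) (MvPowerSeries.rename (Equiv.swap a b) h) =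
      MvPowerSeries.coeff (updTwo a b β q p) h := by
  have h1 := MvPowerSeries.coeff_embDomain_rename (Equiv.swap a b).toEmbedding h
    (updTwo a b β q p)
  rw [← h1]
  congr 1
  congr 1
  ext x
  have h2 : x = (Equiv.swap a b).toEmbedding (Equiv.swap a b x) := by simp
  conv_rhs => rw [h2, Finsupp.embDomain_apply_self]
  unfold updTwo
  by_cases hb : x = b
  · subst hb; simp [Finsupp.update_apply, hab]
  · by_cases ha : x = a
    · subst ha; simp [hab, Function.update]
    · rw [Equiv.swap_apply_of_ne_of_ne ha hb]
      simp [ha, hb, Function.update]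

theorem exists_divDiff {σ k : Type*} [DecidableEq σ] [Finite σ] [Field k] (a b : σ) (hab : a ≠ b)
    (h : MvPowerSeries σ k) : ∃ g : MvPowerSeries σ k,
      (MvPowerSeries.X b - MvPowerSeries.X a) * g = h - MvPowerSeries.rename (Equiv.swap a b) h := by
  set G := h - MvPowerSeries.rename (Equiv.swap a b) h with hG
  let g : MvPowerSeries σ k := fun α =>
    ∑ j ∈ Finset.range (α a + 1), MvPowerSeries.coeff (updTwo a b α (α a - j) (α b + j + 1)) G
  have hg : ∀ α, MvPowerSeries.coeff α g = ∑ j ∈ Finset.range (α a + 1),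
    MvPowerSeries.coeff (updTwo a b α (α a - j) (α b + j + 1)) G := fun α => rfl
  refine ⟨g, ?_⟩
  ext β
  have hself : updTwo a b β (β a) (β b) = β := by simp [updTwo]
  have h1 : MvPowerSeries.coeff β (MvPowerSeries.X b * g) = if β b = 0 then 0 else
      ∑ j ∈ Finset.range (β a + 1), MvPowerSeries.coeff (updTwo a b β (β a - j) (β b + j)) G := by
    rw [MvPowerSeries.X, MvPowerSeries.coeff_monomial_mul]
    by_cases h0 : β b = 0
    · simp [h0, Finsupp.single_le_iff]
    · rw [if_pos (by rw [Finsupp.single_le_iff]; omega), if_neg h0, one_mul, hg]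
      have e1 : (β - Finsupp.single b 1 : σ →₀ ℕ) a = β a := by simp [hab]
      have e2 : (β - Finsupp.single b 1 : σ →₀ ℕ) b = β b - 1 := by simp
      rw [e1, e2]
      refine Finset.sum_congr rfl fun j _ => ?_
      congr 1
      congr 1
      rw [show β b - 1 + j + 1 = β b + j by omega]
      ext x
      by_cases hb : x = b
      · subst hb; simp [updTwo]
      · by_cases ha : x = a
        · subst ha; simp [updTwo, Function.update, hab]
        · simp [updTwo, Function.update, ha, hb]
  have h2 : MvPowerSeries.coeff β (MvPowerSeries.X a * g) =
      ∑ j ∈ Finset.range (β a), MvPowerSeries.coeff (updTwo a b β (β a - (j + 1)) (β b + (j + 1))) G := by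
    rw [MvPowerSeries.X, MvPowerSeries.coeff_monomial_mul]
    by_cases h0 : β a = 0
    · simp [h0, Finsupp.single_le_iff]
    · rw [if_pos (by rw [Finsupp.single_le_iff]; omega), one_mul, hg]
      have e1 : (β - Finsupp.single a 1 : σ →₀ ℕ) a = β a - 1 := by simp
      have e2 : (β - Finsupp.single a 1 : σ →₀ ℕ) b = β b := by simp [hab.symm]
      rw [e1, e2, show β a - 1 + 1 = β a by omega]
      refine Finset.sum_congr rfl fun j _ => ?_
      congr 1
      congr 1
      rw [show β a - 1 - j = β a - (j + 1) by omega]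
      ext x
      by_cases hb : x = b
      · subst hb; simp [updTwo]; omega
      · by_cases ha : x = a
        · subst ha; simp [updTwo, Function.update, hab]
        · simp [updTwo, Function.update, ha, hb]
  rw [sub_mul, map_sub, h1, h2]
  have h3 : ∑ j ∈ Finset.range (β a + 1), MvPowerSeries.coeff (updTwo a b β (β a - j) (β b + j)) G =
    ∑ j ∈ Finset.range (β a), MvPowerSeries.coeff (updTwo a b β (β a - (j + 1)) (β b + (j + 1))) G +
      MvPowerSeries.coeff β G := by
    rw [Finset.sum_range_succ', Nat.sub_zero, Nat.add_zero, hself]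
  by_cases h0 : β b = 0
  · have h4 : ∑ j ∈ Finset.range (β a + 1),
        MvPowerSeries.coeff (updTwo a b β (β a - j) (β b + j)) G = 0 := by
      rw [h0]
      simp only [hG, map_sub, coeff_rename_swap a b hab, zero_add, Finset.sum_sub_distrib]
      rw [sub_eq_zero, ← Finset.sum_range_reflect]
      refine Finset.sum_congr rfl fun j hj => ?_
      rw [Finset.mem_range] at hj
      congr 3
      all_goals omega
    rw [h4] at h3
    rw [if_pos h0, zero_sub]
    exact neg_eq_of_add_eq_zero_right h3.symm
  · rw [if_neg h0, h3]; ring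

/-! ### The completed polynomial representation -/

section

variable {k : Type*} [Field k] {q : kˣ} {m : ℕ}

/-- The ring of formal power series in `n = m + 1` variables. -/
abbrev PS (k : Type*) [Field k] (m : ℕ) : Type _ := MvPowerSeries (Fin (m + 1)) k

instance : IsDomain (PS k m) := NoZeroDivisors.to_isDomain _

/-- The field of fractions of the ring of formal power series. -/
abbrev PSFrac (k : Type*) [Field k] (m : ℕ) : Type _ := FractionRing (PS k m)

variable (k) in
/-- The ring automorphism of the power series ring permuting the variables by `w`. -/
def permPS (w : Equiv.Perm (Fin (m + 1))) : PS k m ≃+* PS k m :=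
  (MvPowerSeries.renameEquiv k w).toRingEquiv

variable (k) in
/-- The automorphism of the field of fractions permuting the variables by `w`. -/
def permFrac (w : Equiv.Perm (Fin (m + 1))) : PSFrac k m ≃+* PSFrac k m :=
  IsFractionRing.ringEquivOfRingEquiv (permPS k w)

theorem permPS_apply (w : Equiv.Perm (Fin (m + 1))) (f : PS k m) :
    permPS k w f = MvPowerSeries.rename w f := rfl

theorem permPS_mul (w v : Equiv.Perm (Fin (m + 1))) (f : PS k m) :
    permPS k w (permPS k v f) = permPS k (w * v) f := by
  simp only [permPS_apply, MvPowerSeries.rename_rename]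
  rfl

theorem permPS_one (f : PS k m) : permPS k 1 f = f := MvPowerSeries.rename_id_apply f

theorem permPS_X (w : Equiv.Perm (Fin (m + 1))) (j : Fin (m + 1)) :
    permPS k w (MvPowerSeries.X j) = MvPowerSeries.X (w j) := MvPowerSeries.rename_X ..

theorem permPS_C (w : Equiv.Perm (Fin (m + 1))) (c : k) :
    permPS k w (MvPowerSeries.C c) = MvPowerSeries.C c := MvPowerSeries.rename_C ..

theorem permFrac_algebraMap (w : Equiv.Perm (Fin (m + 1))) (f : PS k m) :
    permFrac k w (algebraMap _ _ f) = algebraMap _ _ (permPS k w f) :=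
  IsFractionRing.ringEquivOfRingEquiv_algebraMap _ _

theorem permFrac_mul (w v : Equiv.Perm (Fin (m + 1))) (f : PSFrac k m) :
    permFrac k w (permFrac k v f) = permFrac k (w * v) f := by
  obtain ⟨a, b, hb, rfl⟩ := IsFractionRing.div_surjective (A := PS k m) f
  simp only [map_div₀, permFrac_algebraMap, permPS_mul]

/-- The completed polynomial representation `⨁_u k⟦X₁, …, X_n⟧ e_u`, where `u` runs through the
orbit of `i`. The `j`-th power series variable in the component of `u` is the local coordinate
`X_j - q ^ (u_j)`. -/
abbrev PolyRep (i : Fin (m + 1) → Residue q) : Type _ := Orb i → PS k m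

/-- The componentwise field of fractions of the polynomial representation. -/
abbrev FracRep (i : Fin (m + 1) → Residue q) : Type _ := Orb i → PSFrac k m

variable {i : Fin (m + 1) → Residue q}

/-- The action of a permutation, `w (f e_u) = w(f) e_{w • u}`. -/
def perm (w : Equiv.Perm (Fin (m + 1))) : PolyRep i →+* PolyRep i :=
  RingHom.pi fun u => (permPS k w : PS k m →+* PS k m).comp (Pi.evalRingHom _ (w⁻¹ • u))

/-- The action of a permutation, `w (f e_u) = w(f) e_{w • u}`, on fractions. -/
def permF (w : Equiv.Perm (Fin (m + 1))) : FracRep i →+* FracRep i :=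
  RingHom.pi fun u => (permFrac k w : PSFrac k m →+* PSFrac k m).comp
    (Pi.evalRingHom _ (w⁻¹ • u))

/-- The embedding of the polynomial representation into its componentwise field of fractions. -/
def toFrac : PolyRep i →+* FracRep i :=
  RingHom.pi fun u => (algebraMap (PS k m) (PSFrac k m)).comp (Pi.evalRingHom _ u)

variable (i) in
/-- The element `X_j`: its component at `u` is `q ^ (u_j)` plus the local coordinate. -/
def Xel (j : Fin (m + 1)) : PolyRep i :=
  fun u => MvPowerSeries.C ((q ^ (u.1 j : ℤ) : kˣ) : k) + MvPowerSeries.X j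

variable (i) in
/-- The element `X_j⁻¹`. -/
def Xinvel (j : Fin (m + 1)) : PolyRep i := fun u => (Xel i j u)⁻¹

theorem perm_apply (w : Equiv.Perm (Fin (m + 1))) (f : PolyRep i) (u : Orb i) :
    perm w f u = permPS k w (f (w⁻¹ • u)) := rfl

theorem permF_apply (w : Equiv.Perm (Fin (m + 1))) (f : FracRep i) (u : Orb i) :
    permF w f u = permFrac k w (f (w⁻¹ • u)) := rfl

theorem toFrac_apply (f : PolyRep i) (u : Orb i) : toFrac f u = algebraMap _ _ (f u) := rfl

theorem toFrac_injective : Function.Injective (toFrac (i := i)) := by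
  intro f g h
  funext u
  exact IsFractionRing.injective (PS k m) (PSFrac k m) (congrFun h u)

theorem permF_toFrac (w : Equiv.Perm (Fin (m + 1))) (f : PolyRep i) :
    permF w (toFrac f) = toFrac (perm w f) := by
  funext u
  exact permFrac_algebraMap _ _

theorem permF_permF (w v : Equiv.Perm (Fin (m + 1))) (f : FracRep i) :
    permF w (permF v f) = permF (w * v) f := by
  funext u
  simp only [permF_apply, permFrac_mul, mul_inv_rev, mul_smul]

theorem perm_Xel (w : Equiv.Perm (Fin (m + 1))) (j : Fin (m + 1)) :
    perm w (Xel i j) = Xel i (w j) := by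
  funext u
  simp only [perm_apply, Xel, map_add, permPS_C, permPS_X, smul_apply, inv_inv]

theorem Xel_mul_inv (j : Fin (m + 1)) : Xel i j * Xinvel i j = 1 := by
  funext u
  refine MvPowerSeries.mul_inv_cancel _ ?_
  rw [Xel, map_add, MvPowerSeries.constantCoeff_C, MvPowerSeries.constantCoeff_X, add_zero]
  exact Units.ne_zero _

theorem Xel_sub_ne (j l : Fin (m + 1)) (h : j ≠ l) (u : Orb i) : Xel i l u - Xel i j u ≠ 0 := by
  classical
  intro h0
  have h1 := congrArg (MvPowerSeries.coeff (Finsupp.single l 1)) h0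
  simp [Xel, MvPowerSeries.coeff_C, MvPowerSeries.coeff_X, Finsupp.single_left_inj, h.symm] at h1

theorem s_inv (r : Fin m) : (s r)⁻¹ = s r := Equiv.swap_inv _ _

theorem castSucc_ne_succ (r : Fin m) : r.castSucc ≠ r.succ :=
  (Fin.castSucc_lt_succ (i := r)).ne

theorem exists_dividedDifference (r : Fin m) (f : PolyRep i) :
    ∃ g : PolyRep i, (Xel i r.succ - Xel i r.castSucc) * g = f - perm (s r) f := by
  have key : ∀ u : Orb i, ∃ g : PS k m,
      (Xel i r.succ u - Xel i r.castSucc u) * g = f u - perm (s r) f u := by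
    intro u
    by_cases hu : u.1 r.castSucc = u.1 r.succ
    · obtain ⟨g, hg⟩ := exists_divDiff r.castSucc r.succ (castSucc_ne_succ r) (f u)
      refine ⟨g, ?_⟩
      have h1 : (s r)⁻¹ • u = u := by
        apply Subtype.ext
        funext j
        rw [smul_apply, inv_inv]
        unfold s
        rcases eq_or_ne j r.castSucc with rfl | h1
        · rw [Equiv.swap_apply_left, hu]
        · rcases eq_or_ne j r.succ with rfl | h2
          · rw [Equiv.swap_apply_right, hu]
          · rw [Equiv.swap_apply_of_ne_of_ne h1 h2]
      rw [perm_apply, h1]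
      simp only [Xel, hu, add_sub_add_left_eq_sub]
      exact hg
    · have h1 : MvPowerSeries.constantCoeff (Xel i r.succ u - Xel i r.castSucc u) ≠ 0 := by
        simp only [Xel, map_sub, map_add, MvPowerSeries.constantCoeff_C,
          MvPowerSeries.constantCoeff_X, add_zero]
        rw [sub_ne_zero]
        intro h2
        exact hu (Residue.zpow_injective q (Units.ext h2.symm))
      refine ⟨(Xel i r.succ u - Xel i r.castSucc u)⁻¹ * (f u - perm (s r) f u), ?_⟩
      rw [← mul_assoc, MvPowerSeries.mul_inv_cancel _ h1, one_mul]
  choose g hg using key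
  exact ⟨g, funext hg⟩

/-- The divided difference `(f - s_r f) / (X_{r+1} - X_r)`. -/
def divDiff (r : Fin m) (f : PolyRep i) : PolyRep i := (exists_dividedDifference r f).choose

theorem divDiff_spec (r : Fin m) (f : PolyRep i) :
    (Xel i r.succ - Xel i r.castSucc) * divDiff r f = f - perm (s r) f :=
  (exists_dividedDifference r f).choose_spec

theorem perm_smul (w : Equiv.Perm (Fin (m + 1))) (c : k) (f : PolyRep i) :
    perm w (c • f) = c • perm w f := by
  funext u
  simp only [perm_apply, Pi.smul_apply, permPS_apply, map_smul]

/-- The operator `T_r`, determined by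
`(T_r + 1) f = (q X_{r+1} - X_r) / (X_{r+1} - X_r) * (f - s_r f)`. -/
def opT (r : Fin m) : Module.End k (PolyRep i) where
  toFun f := (algebraMap k _ (q : k) * Xel i r.succ - Xel i r.castSucc) * divDiff r f - f
  map_add' f g := by
    have h : divDiff r (f + g) = divDiff r f + divDiff r g := by
      funext u
      refine mul_left_cancel₀ (Xel_sub_ne (i := i) _ _ (castSucc_ne_succ r) u) ?_
      have h1 := congrFun (divDiff_spec r (f + g)) u
      have h2 := congrFun (divDiff_spec r f) u
      have h3 := congrFun (divDiff_spec r g) u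
      rw [map_add] at h1
      simp only [Pi.mul_apply, Pi.sub_apply, Pi.add_apply] at h1 h2 h3 ⊢
      rw [h1, mul_add, h2, h3]; ring
    rw [h]; ring
  map_smul' c f := by
    have h : divDiff r (c • f) = c • divDiff r f := by
      funext u
      refine mul_left_cancel₀ (Xel_sub_ne (i := i) _ _ (castSucc_ne_succ r) u) ?_
      have h1 := congrFun (divDiff_spec r (c • f)) u
      have h2 := congrFun (divDiff_spec r f) u
      rw [perm_smul] at h1
      simp only [Pi.mul_apply, Pi.sub_apply, Pi.smul_apply] at h1 h2 ⊢
      rw [h1, mul_smul_comm, h2, smul_sub]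
    rw [h, mul_smul_comm, RingHom.id_apply, smul_sub]

/-- The operators by which the generators of the affine Hecke algebra act. -/
def opGen : Gen m → Module.End k (PolyRep i)
  | Gen.T r => opT r
  | Gen.X j => LinearMap.mulLeft k (Xel i j)
  | Gen.Xinv j => LinearMap.mulLeft k (Xinvel i j)

/-- The rational function `X_j` as an element of the componentwise field of fractions. -/
abbrev XF (i : Fin (m + 1) → Residue q) (j : Fin (m + 1)) : FracRep i := toFrac (Xel i j)

/-- The constant `q` as an element of the componentwise field of fractions. -/
abbrev qF (i : Fin (m + 1) → Residue q) : FracRep i :=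
  toFrac (algebraMap k (PolyRep i) (q : k))

theorem permF_XF (w : Equiv.Perm (Fin (m + 1))) (j : Fin (m + 1)) :
    permF w (XF i j) = XF i (w j) := by
  rw [XF, permF_toFrac, perm_Xel]

theorem permF_qF (w : Equiv.Perm (Fin (m + 1))) : permF w (qF i) = qF i := by
  rw [qF, permF_toFrac]
  congr 1
  funext u
  exact permPS_C w _

theorem XF_sub_ne (j l : Fin (m + 1)) (h : j ≠ l) (u : Orb i) : XF i l u - XF i j u ≠ 0 := by
  intro h0
  change algebraMap (PS k m) (PSFrac k m) (Xel i l u) - algebraMap _ _ (Xel i j u) = 0 at h0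
  rw [← map_sub] at h0
  apply Xel_sub_ne j l h u
  exact IsFractionRing.injective (PS k m) (PSFrac k m) (by rw [h0, map_zero])

theorem toFrac_opT (r : Fin m) (f : PolyRep i) : toFrac (opT r f) =
    (qF i * XF i r.succ - XF i r.castSucc) / (XF i r.succ - XF i r.castSucc) *
      (toFrac f - permF (s r) (toFrac f)) - toFrac f := by
  have h := congrArg toFrac (divDiff_spec r f)
  rw [map_mul, map_sub, map_sub] at h
  rw [permF_toFrac, ← h]
  change toFrac ((algebraMap k _ (q : k) * Xel i r.succ - Xel i r.castSucc) * divDiff r f - f) = _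
  rw [map_sub, map_mul, map_sub, map_mul]
  congr 1
  funext u
  have h0 := XF_sub_ne (i := i) _ _ (castSucc_ne_succ r) u
  simp only [Pi.mul_apply, Pi.sub_apply, Pi.div_apply]
  field_simp

theorem permF_div (w : Equiv.Perm (Fin (m + 1))) (f g : FracRep i) :
    permF w (f / g) = permF w f / permF w g := by
  funext u
  simp only [permF_apply, Pi.div_apply, map_div₀]

/-- The operator `T_r` on fractions. -/
def TF (r : Fin m) (f : FracRep i) : FracRep i :=
  (qF i * XF i r.succ - XF i r.castSucc) / (XF i r.succ - XF i r.castSucc) *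
    (f - permF (s r) f) - f

theorem s_castSucc (r : Fin m) : s r r.castSucc = r.succ := Equiv.swap_apply_left _ _

theorem s_succ (r : Fin m) : s r r.succ = r.castSucc := Equiv.swap_apply_right _ _

theorem s_of_ne (r : Fin m) (j : Fin (m + 1)) (h₁ : j ≠ r.castSucc) (h₂ : j ≠ r.succ) :
    s r j = j := Equiv.swap_apply_of_ne_of_ne h₁ h₂

theorem s_mul_self (r : Fin m) : s r * s r = 1 := Equiv.swap_mul_self _ _

theorem permF_s_s (r : Fin m) (f : FracRep i) : permF (s r) (permF (s r) f) = f := by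
  rw [permF_permF, s_mul_self]
  funext u
  rw [permF_apply, inv_one, one_smul]
  obtain ⟨a, b, hb, h⟩ := IsFractionRing.div_surjective (A := PS k m) (f u)
  rw [← h, map_div₀, permFrac_algebraMap, permFrac_algebraMap]
  rw [permPS_one, permPS_one]

theorem TF_quad (r : Fin m) (f : FracRep i) :
    TF r (TF r f + f) - qF i * (TF r f + f) = 0 := by
  simp only [TF, map_sub, map_add, map_mul, permF_div, permF_XF, permF_qF, permF_s_s, s_castSucc,
    s_succ]
  funext u
  have h1 := XF_sub_ne (i := i) _ _ (castSucc_ne_succ r) u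
  have h2 := XF_sub_ne (i := i) _ _ (castSucc_ne_succ r).symm u
  simp only [Pi.mul_apply, Pi.sub_apply, Pi.div_apply, Pi.add_apply, Pi.zero_apply]
  generalize XF i r.succ u = y at *
  generalize XF i r.castSucc u = x at *
  have h3 : x - y = - (y - x) := by ring
  rw [h3]
  field_simp
  ring

theorem TF_T_X (r : Fin m) (j : Fin (m + 1)) (h₁ : j ≠ r.castSucc) (h₂ : j ≠ r.succ)
    (f : FracRep i) : TF r (XF i j * f) = XF i j * TF r f := by
  simp only [TF, map_mul, permF_XF, s_of_ne r j h₁ h₂]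
  ring

theorem TF_T_X_T (r : Fin m) (f : FracRep i) :
    TF r (XF i r.castSucc * TF r f) = qF i * (XF i r.succ * f) := by
  simp only [TF, map_sub, map_mul, permF_div, permF_XF, permF_qF, permF_s_s, s_castSucc,
    s_succ]
  funext u
  have h1 := XF_sub_ne (i := i) _ _ (castSucc_ne_succ r) u
  have h2 := XF_sub_ne (i := i) _ _ (castSucc_ne_succ r).symm u
  simp only [Pi.mul_apply, Pi.sub_apply, Pi.div_apply]
  generalize XF i r.succ u = y at *
  generalize XF i r.castSucc u = x at *
  have h3 : x - y = - (y - x) := by ring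
  rw [h3]
  field_simp
  ring

theorem TF_comm (r t : Fin m) (h : (r : ℕ) + 1 < t) (f : FracRep i) :
    TF r (TF t f) = TF t (TF r f) := by
  have a1 : s r t.castSucc = t.castSucc :=
    s_of_ne _ _ (by simp [Fin.ext_iff]; omega) (by simp [Fin.ext_iff]; omega)
  have a2 : s r t.succ = t.succ :=
    s_of_ne _ _ (by simp [Fin.ext_iff]; omega) (by simp [Fin.ext_iff]; omega)
  have a3 : s t r.castSucc = r.castSucc :=
    s_of_ne _ _ (by simp [Fin.ext_iff]; omega) (by simp [Fin.ext_iff]; omega)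
  have a4 : s t r.succ = r.succ :=
    s_of_ne _ _ (by simp [Fin.ext_iff]; omega) (by simp [Fin.ext_iff]; omega)
  have hs : s r * s t = s t * s r := by
    have := Equiv.mul_swap_eq_swap_mul (s r) t.castSucc t.succ
    rw [a1, a2] at this
    exact this
  have hp : permF (s r) (permF (s t) f) = permF (s t) (permF (s r) f) := by
    rw [permF_permF, permF_permF, hs]
  simp only [TF, map_sub, map_mul, permF_div, permF_XF, permF_qF, a1, a2, a3, a4, hp]
  ring

theorem TF_braid (r t : Fin m) (h : (r : ℕ) + 1 = t) (f : FracRep i) :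
    TF r (TF t (TF r f)) = TF t (TF r (TF t f)) := by
  have e : t.castSucc = r.succ := by simp [Fin.ext_iff]; omega
  have a2 : s r t.succ = t.succ :=
    s_of_ne _ _ (by simp [Fin.ext_iff]; omega) (by simp [Fin.ext_iff]; omega)
  have a3 : s t r.castSucc = r.castSucc :=
    s_of_ne _ _ (by simp [Fin.ext_iff]; omega) (by simp [Fin.ext_iff]; omega)
  have a4 : s t r.succ = t.succ := by rw [← e]; exact s_castSucc t
  have a5 : s t t.succ = r.succ := by rw [← e]; exact s_succ t
  have hs : s t * s r * s t = s r * s t * s r := by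
    have h1 := Equiv.mul_swap_eq_swap_mul (s t * s r) t.castSucc t.succ
    have b1 : (s t * s r) t.castSucc = r.castSucc := by
      rw [Equiv.Perm.mul_apply, e, s_succ, a3]
    have b2 : (s t * s r) t.succ = r.succ := by
      rw [Equiv.Perm.mul_apply, a2, a5]
    rw [b1, b2] at h1
    change s t * s r * s t = s r * (s t * s r) at h1
    rw [h1, mul_assoc]
  have hp : permF (s t) (permF (s r) (permF (s t) f)) =
      permF (s r) (permF (s t) (permF (s r) f)) := by
    simp only [permF_permF, ← mul_assoc, hs]
  have n1 : r.castSucc ≠ t.succ := by simp [Fin.ext_iff]; omega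
  have n2 : r.succ ≠ t.succ := by rw [← e]; exact castSucc_ne_succ t
  simp only [TF, map_sub, map_mul, permF_div, permF_XF, permF_qF, permF_s_s, e, s_castSucc,
    s_succ, a2, a3, a4, a5, hp]
  funext u
  have h1 := XF_sub_ne (i := i) _ _ (castSucc_ne_succ r) u
  have h2 := XF_sub_ne (i := i) _ _ n1 u
  have h3 := XF_sub_ne (i := i) _ _ n2 u
  simp only [Pi.mul_apply, Pi.sub_apply, Pi.div_apply]
  generalize XF i r.succ u = y at *
  generalize XF i r.castSucc u = x at *
  generalize XF i t.succ u = z at *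
  rw [← neg_sub y x, ← neg_sub z y]
  field_simp
  ring

theorem toFrac_opT' (r : Fin m) (f : PolyRep i) : toFrac (opT r f) = TF r (toFrac f) :=
  toFrac_opT r f

theorem toFrac_algebraMap_mul (f : PolyRep i) :
    toFrac ((q : k) • f) = qF i * toFrac f := by
  rw [Algebra.smul_def, map_mul]

theorem op_rel {x y : FreeAlgebra k (Gen m)} (h : Rel q m x y) :
    FreeAlgebra.lift k (opGen (i := i)) x = FreeAlgebra.lift k (opGen (i := i)) y := by
  apply LinearMap.ext
  intro f
  cases h with
  | quad r =>
    apply toFrac_injective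
    simp only [map_mul, map_sub, map_add, map_one, map_zero, FreeAlgebra.lift_ι_apply, opGen,
      AlgHom.commutes, Module.End.mul_apply, LinearMap.sub_apply, LinearMap.add_apply,
      Module.End.one_apply, Module.algebraMap_end_apply, LinearMap.zero_apply]
    have h := TF_quad r (toFrac f)
    rw [← toFrac_opT', ← map_add, ← toFrac_opT', ← toFrac_algebraMap_mul, ← map_sub] at h
    rw [map_add (opT r), smul_add, map_sub, map_add, map_add] at h
    rw [← h]
    ring
  | comm r t h =>
    apply toFrac_injective
    simp only [map_mul, FreeAlgebra.lift_ι_apply, opGen, Module.End.mul_apply, toFrac_opT',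
      TF_comm r t h]
  | braid r t h =>
    apply toFrac_injective
    simp only [map_mul, FreeAlgebra.lift_ι_apply, opGen, Module.End.mul_apply, toFrac_opT',
      TF_braid r t h]
  | X_mul_inv j =>
    simp only [map_mul, map_one, FreeAlgebra.lift_ι_apply, opGen, Module.End.mul_apply,
      LinearMap.mulLeft_apply, Module.End.one_apply]
    rw [← mul_assoc, Xel_mul_inv, one_mul]
  | inv_mul_X j =>
    simp only [map_mul, map_one, FreeAlgebra.lift_ι_apply, opGen, Module.End.mul_apply,
      LinearMap.mulLeft_apply, Module.End.one_apply]
    rw [← mul_assoc, mul_comm (Xinvel i j), Xel_mul_inv, one_mul]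
  | X_comm j l =>
    simp only [map_mul, FreeAlgebra.lift_ι_apply, opGen, Module.End.mul_apply,
      LinearMap.mulLeft_apply]
    ring
  | T_X r j h₁ h₂ =>
    apply toFrac_injective
    simp only [map_mul, FreeAlgebra.lift_ι_apply, opGen, Module.End.mul_apply, toFrac_opT',
      LinearMap.mulLeft_apply]
    exact TF_T_X r j h₁ h₂ _
  | T_X_T r =>
    apply toFrac_injective
    simp only [map_mul, FreeAlgebra.lift_ι_apply, opGen, Module.End.mul_apply, toFrac_opT',
      LinearMap.mulLeft_apply, AlgHom.commutes, Module.algebraMap_end_apply, toFrac_algebraMap_mul]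
    exact TF_T_X_T r _

variable (i) in
/-- The polynomial representation of the affine Hecke algebra on `⨁_u k⟦X₁, …, X_n⟧ e_u`. -/
def heckeRep : Hecke q m →ₐ[k] Module.End k (PolyRep i) :=
  RingQuot.liftAlgHom k ⟨FreeAlgebra.lift k opGen, fun _ _ h => op_rel h⟩

variable (i) in
/-- The action of the completed affine Hecke algebra on the polynomial representation. The
`r`-th power of the ideal maps into the series of order at least `r`, so the coefficients of degree
less than `r` are computed modulo the `r`-th power of the ideal. -/
def hatAct (x : HeckeHat i) (f : PolyRep i) : PolyRep i :=
  fun u α => MvPowerSeries.coeff α (heckeRep i (approx i (α.degree + 1) x) f u)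

end

/-! ### The twisted completed faithful representation -/

section

variable {k : Type*} [Field k] {q : kˣ} {m : ℕ} {i : Fin (m + 1) → Residue q}

open Classical in
/-- The map `g ↦ ∑_w w(g) e_{w • u}`, where `w` runs through the minimal length representatives of
the cosets in `W_J` of the stabiliser of `u`. -/
def xi (J : Finset (Fin m)) (u : Orb i) (g : PS k m) : PolyRep i :=
  ∑ w ∈ cosetReps J (stab J u), Pi.single (w • u) (permPS k w g)

/-- The space `R̂_{+,u}` for `u ∈ U J`: the image under `xi J u` of the power series
invariant under the stabiliser of `u` in `W_J`. -/
def Rhat (J : Finset (Fin m)) (u : Orb i) : Set (PolyRep i) :=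
  {f | ∃ g : PS k m, (∀ w ∈ parabolic (stab J u), permPS k w g = g) ∧ f = xi J u g}

variable (i) in
/-- The space `⨁_J ⨁_{u ∈ U J} R̂_{+,u} v̄^{(J)}`, as a subspace of `⨁_J PolyRep v̄^{(J)}`. -/
def twistedRep : Submodule k (Finset (Fin m) → PolyRep i) :=
  Submodule.pi Set.univ fun J => Submodule.span k (⋃ u ∈ (U J : Set (Orb i)), Rhat J u)

variable (i) in
/-- The right ideal generated by `v_J^♯` in the completed affine Hecke algebra. -/
def vIdeal (J : Finset (Fin m)) : Submodule (HeckeHat i)ᵐᵒᵖ (HeckeHat i) :=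
  Submodule.span (HeckeHat i)ᵐᵒᵖ {toHat i (vHash q J)}

variable (i) in
/-- The generator `v_J^♯` of `vIdeal i J`. -/
def vGen (J : Finset (Fin m)) : vIdeal i J :=
  ⟨toHat i (vHash q J), Submodule.mem_span_singleton_self _⟩

variable (i) in
/-- The completed affine Schur algebra in its twisted form: the endomorphisms of the right module
`⨁_J v_J^♯ Ĥ` over the completed affine Hecke algebra `Ĥ`. -/
abbrev SchurHat : Type _ :=
  Module.End (HeckeHat i)ᵐᵒᵖ (∀ J : Finset (Fin m), vIdeal i J)

open Classical in
/-- An element `h` of the completed affine Hecke algebra such that the component of `φ` from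
`v_J^♯ Ĥ` to `v_K^♯ Ĥ` sends `v_J^♯` to `h v_J^♯`. -/
def coeffHat (φ : SchurHat i) (K J : Finset (Fin m)) : HeckeHat i :=
  if h : ∃ x : HeckeHat i, (φ (Pi.single J (vGen i J)) K : HeckeHat i) = x * toHat i (vHash q J)
  then h.choose else 0

/-- The action of the completed affine Schur algebra: if `φ` sends `v_J^♯` to `∑_K h_K v_J^♯` then
`φ (f v̄^{(J)}) = ∑_K (h_K f) v̄^{(K)}`. -/
def rho (φ : SchurHat i) (F : Finset (Fin m) → PolyRep i) : Finset (Fin m) → PolyRep i :=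
  fun K => ∑ J, hatAct i (coeffHat φ K J) (F J)

open Classical in
/-- The characterisation of the basis element `b^1_{K,J}` of the Schur algebra: it sends `v_J^♯` to
`∑_{w ∈ W_K W_J} T_w^♯`, placed in the summand of `K`, and vanishes on all other summands. -/
def IsBasisOne (K J : Finset (Fin m)) (φ : SchurHat i) : Prop :=
  (∀ L, (φ (Pi.single J (vGen i J)) L : HeckeHat i) =
    if L = K then toHat i (∑ w ∈ doubleCosetOne K J, hash q (Tw q w)) else 0) ∧
  ∀ J', J' ≠ J → ∀ x : vIdeal i J', φ (Pi.single J' x) = 0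

variable (i) in
/-- The rational function `θ_{j,l} = (q X_j - X_l) / (X_j - X_l)`. -/
def theta (j l : Fin (m + 1)) : FracRep i := (qF i * XF i j - XF i l) / (XF i j - XF i l)

/-- The symmetrising operator `⋔^t_{t'}`: the sum over the minimal length representatives of the
cosets of the Young subgroup of type `t'` in the Young subgroup of type `t`. -/
def symmetrise (t t' : List ℕ) (f : FracRep i) : FracRep i :=
  ∑ w ∈ cosetReps (ofType (m := m) t) (ofType t'), permF w f

variable (i) in
/-- The distinct entries of the residue sequence `i`, in increasing order. -/
def entries : List (Residue q) := (Finset.univ.image i).sort (· ≤ ·)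

/-- The multiplicities `d_c` of the entries `c` in `u`. -/
def multiplicities (u : Orb i) : List ℕ :=
  (entries i).map fun c => (Finset.univ.filter fun j => u.1 j = c).card

/-- The sequence `a₁, b₁, a₂, b₂, …` of the multiplicities of the entries in the first block (the
positions up to `a`) and in the second block (the positions after `a`) of `u`. -/
def splitMultiplicities (a : Fin m) (u : Orb i) : List ℕ :=
  (entries i).flatMap fun c =>
    [(Finset.univ.filter fun j => j ≤ a.castSucc ∧ u.1 j = c).card,
      (Finset.univ.filter fun j => a.castSucc < j ∧ u.1 j = c).card]

end

end
end AffineSchur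

open AffineSchur

namespace AffineSchur

noncomputable section

/-! ### Inversions and the length function -/

section Length

variable {m : ℕ}

/-! Write `W` for the symmetric group and `W_J` for the maximal parabolic subgroup omitting `a`.
Lengths add in `d v` for `d` a minimal representative of `W / W_J` and `v ∈ W_J`, so `h = ∑ T_d^♯`
satisfies `h v_J^♯ = v_W^♯` (`vHash_univ_eq`). Left multiplication by `h` is the required
endomorphism, and it is unique because `v_J^♯` generates its summand.

The action rests on the formula `v_J^♯ f = ∑_{w ∈ W_J} w(Θ_J f)`, where `Θ_J` is the product of the
`θ_{j,l}` over pairs `j < l` in one block (`toFrac_vHash`). Indeed `T_r^♯ = q - θ + θ s_r` with `θ =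
θ_{r+1,r}`, so `v_J^♯ = ∑ c_v v`, and the coefficient of the longest element is an explicit product
of `θ`s. Since `T_r^♯ v_J^♯ = q v_J^♯`, the image of `v_J^♯` is `W_J`-invariant; by independence of
characters this means `c_{wv} = w(c_v)`, and the longest element determines every coefficient.

Now let `x v_J^♯ = v_W^♯` and let `f` be `W_J`-invariant. Choose a fraction `e` with `∑_{w ∈ W_J}
w(e) = 1`. For a suitable `W`-invariant `z` one has `z f = v_J^♯ g` with `Θ_J g = z e f`. The
completed algebra commutes with `z`, hence `z (x f) = v_W^♯ g`, and cancelling `z` gives `x f = ∑_{w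
∈ W} w(Θ e f)`, where `Θ = Θ_W / Θ_J` is the product over the pairs straddling the cut at `a`
(`toFrac_hatAct`). The result is independent of the choice of `x` and `W`-invariant, so it lies in
the faithful representation.

At `u_K` only the `w = x σ y` with `x` in the stabiliser of `u_K` and `y ∈ W_J` contribute. Summing
over `y` removes `e`, and `x` remains modulo the stabiliser intersected with `σ W_J σ⁻¹`, which is
the Young subgroup of the split type because `σ` has minimal length (`sum_permF_apply_sorted`).

All parabolic subgroups are treated uniformly as stabilisers of weakly increasing functions
(`mem_parabolic_steps`). -/

/-- The pairs of positions in the wrong order. -/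
def inversions (w : Equiv.Perm (Fin (m + 1))) : Finset (Fin (m + 1) × Fin (m + 1)) :=
  Finset.univ.filter fun p => p.1 < p.2 ∧ w p.2 < w p.1

theorem mem_inversions {w : Equiv.Perm (Fin (m + 1))} {p : Fin (m + 1) × Fin (m + 1)} :
    p ∈ inversions w ↔ p.1 < p.2 ∧ w p.2 < w p.1 := by
  rw [inversions, Finset.mem_filter, and_iff_right (Finset.mem_univ _)]

theorem s_s_apply (r : Fin m) (j : Fin (m + 1)) : s r (s r j) = j := Equiv.swap_apply_self _ _ _

/-- The two exchanged positions are adjacent, so no third position changes its order relative to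
either of them. -/
theorem s_lt_s {r : Fin m} {a b : Fin (m + 1)} (hab : a < b)
    (h : ¬ (a = r.castSucc ∧ b = r.succ)) : s r a < s r b := by
  unfold s
  rw [Equiv.swap_apply_def, Equiv.swap_apply_def]
  rw [Fin.ext_iff, Fin.ext_iff, Fin.val_castSucc, Fin.val_succ] at h
  rw [Fin.lt_def] at hab ⊢
  split_ifs with h1 h2 h3 h4 h5 <;>
    simp only [Fin.ext_iff, Fin.val_castSucc, Fin.val_succ] at * <;> omega

theorem castSucc_succ_mem_inversions {w : Equiv.Perm (Fin (m + 1))} {r : Fin m}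
    (h : w r.castSucc < w r.succ) : (r.castSucc, r.succ) ∈ inversions (w * s r) := by
  rw [mem_inversions]
  simp [s_castSucc, s_succ, h]

theorem map_s_mem_inversions {w : Equiv.Perm (Fin (m + 1))} {r : Fin m}
    (h : w r.castSucc < w r.succ) {p : Fin (m + 1) × Fin (m + 1)} (hp : p ∈ inversions w) :
    (s r p.1, s r p.2) ∈ (inversions (w * s r)).erase (r.castSucc, r.succ) := by
  obtain ⟨a, b⟩ := p
  simp only [Finset.mem_erase, mem_inversions, ne_eq, Prod.mk.injEq, Equiv.Perm.mul_apply,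
    s_s_apply] at hp ⊢
  have hne : ¬ (a = r.castSucc ∧ b = r.succ) := by
    rintro ⟨rfl, rfl⟩
    exact absurd hp.2 h.not_gt
  refine ⟨?_, s_lt_s hp.1 hne, hp.2⟩
  rintro ⟨ha, hb⟩
  have ha' : a = r.succ := by rw [← s_s_apply r a, ha, s_castSucc]
  have hb' : b = r.castSucc := by rw [← s_s_apply r b, hb, s_succ]
  rw [ha', hb'] at hp
  exact absurd hp.1 Fin.castSucc_lt_succ.not_gt

theorem map_s_mem_inversions_of_mem {w : Equiv.Perm (Fin (m + 1))} {r : Fin m}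
    {p : Fin (m + 1) × Fin (m + 1)}
    (hp : p ∈ (inversions (w * s r)).erase (r.castSucc, r.succ)) :
    (s r p.1, s r p.2) ∈ inversions w := by
  obtain ⟨a, b⟩ := p
  simp only [Finset.mem_erase, mem_inversions, ne_eq, Prod.mk.injEq,
    Equiv.Perm.mul_apply] at hp ⊢
  exact ⟨s_lt_s hp.2.1 hp.1, hp.2.2⟩

/-- Passing to `w * s r` at an ascent creates one inversion and transports the others by `s r`. The
weighted form computes the leading coefficient of `T_w^♯`. -/
theorem prod_inversions_mul_s {M : Type*} [CommMonoid M] {w : Equiv.Perm (Fin (m + 1))}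
    {r : Fin m} (h : w r.castSucc < w r.succ) (f : Fin (m + 1) × Fin (m + 1) → M) :
    ∏ p ∈ inversions (w * s r), f p =
      f (r.castSucc, r.succ) * ∏ p ∈ inversions w, f (s r p.1, s r p.2) := by
  rw [← Finset.mul_prod_erase _ _ (castSucc_succ_mem_inversions h)]
  congr 1
  refine Finset.prod_nbij' (fun p => (s r p.1, s r p.2)) (fun p => (s r p.1, s r p.2))
    (fun p hp => map_s_mem_inversions_of_mem hp) (fun p hp => map_s_mem_inversions h hp) ?_ ?_ ?_
  all_goals simp [s_s_apply]

theorem card_inversions_mul_s {w : Equiv.Perm (Fin (m + 1))} {r : Fin m}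
    (h : w r.castSucc < w r.succ) :
    (inversions (w * s r)).card = (inversions w).card + 1 := by
  rw [← Finset.card_erase_add_one (castSucc_succ_mem_inversions h)]
  congr 1
  refine Finset.card_nbij' (fun p => (s r p.1, s r p.2)) (fun p => (s r p.1, s r p.2))
    (fun p hp => map_s_mem_inversions_of_mem hp) (fun p hp => map_s_mem_inversions h hp) ?_ ?_
  all_goals simp [s_s_apply, Set.LeftInvOn]

theorem mul_s_mul_s (w : Equiv.Perm (Fin (m + 1))) (r : Fin m) : w * s r * s r = w := by
  rw [mul_assoc, s_mul_self, mul_one]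

theorem card_inversions_mul_s_of_gt {w : Equiv.Perm (Fin (m + 1))} {r : Fin m}
    (h : w r.succ < w r.castSucc) :
    (inversions (w * s r)).card + 1 = (inversions w).card := by
  rw [← card_inversions_mul_s (w := w * s r) (r := r), mul_s_mul_s]
  simpa [s_castSucc, s_succ] using h

theorem apply_lt_or_gt (w : Equiv.Perm (Fin (m + 1))) (r : Fin m) :
    w r.castSucc < w r.succ ∨ w r.succ < w r.castSucc :=
  lt_or_gt_of_ne fun h => castSucc_ne_succ r (w.injective h)

theorem eq_one_of_ascents {w : Equiv.Perm (Fin (m + 1))}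
    (h : ∀ r : Fin m, w r.castSucc < w r.succ) : w = 1 := by
  have hm : StrictMono w := Fin.strictMono_iff_lt_succ.2 h
  have h1 := Subsingleton.elim (hm.orderIsoOfSurjective _ w.surjective) (OrderIso.refl _)
  ext j
  exact congrArg Fin.val (DFunLike.congr_fun h1 j)

/-- Induction along reduced words of the elements preserving a weakly increasing function. -/
@[elab_as_elim]
theorem stabilizer_induction {α : Type*} [LinearOrder α] {φ : Fin (m + 1) → α} (hφ : Monotone φ)
    {P : Equiv.Perm (Fin (m + 1)) → Prop} (one : P 1)
    (mul_s : ∀ (w : Equiv.Perm (Fin (m + 1))) (r : Fin m), (∀ j, φ (w j) = φ j) →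
      φ r.castSucc = φ r.succ → w r.castSucc < w r.succ → P w → P (w * s r))
    (w : Equiv.Perm (Fin (m + 1))) (hw : ∀ j, φ (w j) = φ j) : P w := by
  induction hn : (inversions w).card using Nat.strong_induction_on generalizing w with
  | _ n ih =>
    by_cases h : ∀ r : Fin m, w r.castSucc < w r.succ
    · rw [eq_one_of_ascents h]; exact one
    · push Not at h
      obtain ⟨r, hr⟩ := h
      have hr' : w r.succ < w r.castSucc := (apply_lt_or_gt w r).resolve_left hr.not_gt
      -- A descent of `w` must stay inside a fibre: `w` preserves the weakly increasing `φ`, so `φ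
      -- (r+1) = φ (w (r+1)) ≤ φ (w r) = φ r`.
      have hφr : φ r.castSucc = φ r.succ := by
        refine le_antisymm (hφ Fin.castSucc_lt_succ.le) ?_
        rw [← hw r.succ, ← hw r.castSucc]
        exact hφ hr
      have hs : ∀ j, φ ((w * s r) j) = φ j := by
        intro j
        rw [Equiv.Perm.mul_apply, hw]
        unfold s
        rw [Equiv.swap_apply_def]
        split_ifs with h1 h2
        · rw [h1, hφr]
        · rw [h2, hφr]
        · rfl
      have h1 := card_inversions_mul_s_of_gt hr'
      have h2 := mul_s (w * s r) r hs hφr (by simpa [s_castSucc, s_succ] using hr')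
        (ih _ (by omega) _ hs rfl)
      rwa [mul_s_mul_s] at h2

theorem perm_induction {P : Equiv.Perm (Fin (m + 1)) → Prop} (one : P 1)
    (mul_s : ∀ (w : Equiv.Perm (Fin (m + 1))) (r : Fin m),
      w r.castSucc < w r.succ → P w → P (w * s r)) (w : Equiv.Perm (Fin (m + 1))) : P w :=
  stabilizer_induction (φ := fun _ => ()) (fun _ _ _ => le_rfl) one
    (fun w r _ _ h => mul_s w r h) w fun _ => rfl

theorem len_prod_le (l : List (Fin m)) : len (l.map s).prod ≤ l.length :=
  Nat.sInf_le ⟨l, rfl, rfl⟩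

theorem card_inversions_prod_le (l : List (Fin m)) :
    (inversions (l.map s).prod).card ≤ l.length := by
  induction l using List.reverseRecOn with
  | nil =>
    simp only [List.map_nil, List.prod_nil, List.length_nil, nonpos_iff_eq_zero,
      Finset.card_eq_zero, inversions, Finset.filter_eq_empty_iff, Equiv.Perm.one_apply]
    exact fun p _ h => lt_asymm h.1 h.2
  | append_singleton l r ih =>
    rw [List.map_append, List.prod_append, List.map_singleton, List.prod_singleton,
      List.length_append, List.length_singleton]
    rcases apply_lt_or_gt (l.map s).prod r with h | h
    · rw [card_inversions_mul_s h]; omega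
    · have := card_inversions_mul_s_of_gt h; omega

/-- Each letter of a word changes the number of inversions by exactly one, and a permutation can be
built from the identity by ascents alone. -/
theorem len_eq_card_inversions (w : Equiv.Perm (Fin (m + 1))) :
    len w = (inversions w).card := by
  apply le_antisymm
  · induction w using perm_induction with
    | one => exact (len_prod_le []).trans (Nat.zero_le _)
    | mul_s w r h ih =>
      obtain ⟨l, hl, hl'⟩ := exists_reducedWord w
      rw [card_inversions_mul_s h]
      have h1 := len_prod_le (l ++ [r])
      rw [List.map_append, List.prod_append, List.map_singleton, List.prod_singleton,
        List.length_append, List.length_singleton, hl, hl'] at h1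
      omega
  · obtain ⟨l, hl, hl'⟩ := exists_reducedWord w
    have := card_inversions_prod_le l
    rwa [hl, hl'] at this

theorem len_one : len (1 : Equiv.Perm (Fin (m + 1))) = 0 :=
  Nat.le_zero.1 (len_prod_le [])

theorem len_mul_s {w : Equiv.Perm (Fin (m + 1))} {r : Fin m} (h : w r.castSucc < w r.succ) :
    len (w * s r) = len w + 1 := by
  rw [len_eq_card_inversions, len_eq_card_inversions, card_inversions_mul_s h]

theorem len_mul_s_of_gt {w : Equiv.Perm (Fin (m + 1))} {r : Fin m}
    (h : w r.succ < w r.castSucc) : len (w * s r) + 1 = len w := by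
  rw [len_eq_card_inversions, len_eq_card_inversions, card_inversions_mul_s_of_gt h]

theorem len_inv_le (w : Equiv.Perm (Fin (m + 1))) : len w⁻¹ ≤ len w := by
  obtain ⟨l, hl, hl'⟩ := exists_reducedWord w
  have h := len_prod_le l.reverse
  rw [List.length_reverse, hl'] at h
  convert h using 2
  rw [← hl, List.prod_inv_reverse, List.map_map, List.map_reverse]
  congr 3

theorem len_inv (w : Equiv.Perm (Fin (m + 1))) : len w⁻¹ = len w :=
  le_antisymm (len_inv_le w) (by simpa using len_inv_le w⁻¹)

theorem len_s_mul {w : Equiv.Perm (Fin (m + 1))} {r : Fin m}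
    (h : w⁻¹ r.castSucc < w⁻¹ r.succ) : len (s r * w) = len w + 1 := by
  rw [← len_inv, mul_inv_rev, s_inv, len_mul_s h, len_inv]

theorem len_s_mul_of_gt {w : Equiv.Perm (Fin (m + 1))} {r : Fin m}
    (h : w⁻¹ r.succ < w⁻¹ r.castSucc) : len (s r * w) + 1 = len w := by
  rw [← len_inv, mul_inv_rev, s_inv, len_mul_s_of_gt h, len_inv]

end Length

/-! ### Parabolic subgroups as stabilizers of weakly increasing functions -/

section Parabolic

variable {m : ℕ} {α : Type*} [LinearOrder α]

/-- The positions at which `φ` does not jump. -/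
def steps (φ : Fin (m + 1) → α) : Finset (Fin m) :=
  Finset.univ.filter fun r => φ r.castSucc = φ r.succ

theorem mem_steps {φ : Fin (m + 1) → α} {r : Fin m} :
    r ∈ steps φ ↔ φ r.castSucc = φ r.succ := by simp [steps]

theorem apply_s_of_eq {β : Type*} {φ : Fin (m + 1) → β} {r : Fin m}
    (h : φ r.castSucc = φ r.succ) (j : Fin (m + 1)) : φ (s r j) = φ j := by
  unfold s
  rw [Equiv.swap_apply_def]
  split_ifs with h1 h2
  · rw [h1, h]
  · rw [h2, h]
  · rfl

/-- A permutation preserving `φ` can be sorted to the identity by removing descents, all of which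
occur at steps of `φ`. Membership in a parabolic subgroup thereby becomes a pointwise condition. -/
theorem mem_parabolic_steps {φ : Fin (m + 1) → α} (hφ : Monotone φ)
    {w : Equiv.Perm (Fin (m + 1))} : w ∈ parabolic (steps φ) ↔ ∀ j, φ (w j) = φ j := by
  constructor
  · intro h
    induction h using Subgroup.closure_induction with
    | mem x hx =>
      obtain ⟨r, hr, rfl⟩ := hx
      exact apply_s_of_eq (mem_steps.1 hr)
    | one => exact fun _ => rfl
    | mul x y _ _ hx hy => exact fun j => (hx _).trans (hy j)
    | inv x _ hx => exact fun j => by simpa using (hx (x⁻¹ j)).symm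
  · refine stabilizer_induction hφ (one_mem _) (fun w r _ hr _ ih => mul_mem ih ?_) w
    exact Subgroup.subset_closure ⟨r, mem_steps.2 hr, rfl⟩

theorem s_mem_parabolic {J : Finset (Fin m)} {r : Fin m} (h : r ∈ J) : s r ∈ parabolic J :=
  Subgroup.subset_closure ⟨r, h, rfl⟩

theorem mem_cosetReps {K J : Finset (Fin m)} {d : Equiv.Perm (Fin (m + 1))} :
    d ∈ cosetReps K J ↔ d ∈ parabolic K ∧ ∀ v ∈ parabolic J, len d ≤ len (d * v) := by
  classical
  rw [cosetReps, Finset.mem_filter, and_iff_right (Finset.mem_univ _)]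

theorem lt_of_mem_cosetReps {K J : Finset (Fin m)} {d : Equiv.Perm (Fin (m + 1))}
    (hd : d ∈ cosetReps K J) {r : Fin m} (hr : r ∈ J) : d r.castSucc < d r.succ := by
  refine (apply_lt_or_gt d r).resolve_right fun h => ?_
  have h1 := (mem_cosetReps.1 hd).2 _ (s_mem_parabolic hr)
  have h2 := len_mul_s_of_gt h
  omega

/-- Fibres of a weakly increasing function are intervals, so the ascents between neighbours chain
up. The codomain is left general in order to use the reversed order for longest elements. -/
theorem lt_of_ascents {φ : Fin (m + 1) → α} (hφ : Monotone φ) {β : Type*} [Preorder β]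
    {d : Fin (m + 1) → β} (hd : ∀ r ∈ steps φ, d r.castSucc < d r.succ)
    {a b : Fin (m + 1)} (hab : a < b)
    (h : φ a = φ b) : d a < d b := by
  induction b using Fin.induction with
  | zero => exact absurd hab (Fin.not_lt_zero a)
  | succ r ih =>
    have har : a ≤ r.castSucc := Fin.le_castSucc_iff.2 hab
    have h1 : φ r.castSucc = φ r.succ :=
      le_antisymm (hφ Fin.castSucc_lt_succ.le) (h ▸ hφ har)
    have h2 := hd r (mem_steps.2 h1)
    rcases har.eq_or_lt with h3 | h3
    · rwa [h3]
    · exact (ih h3 (h.trans h1.symm)).trans h2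

theorem mem_parabolic_of_mem_cosetReps {K J : Finset (Fin m)} {d : Equiv.Perm (Fin (m + 1))}
    (hd : d ∈ cosetReps K J) : d ∈ parabolic K := (mem_cosetReps.1 hd).1

/-- Put `d' = d v`. A descent of `v` would lie in one fibre of `φ`, on which `d` is increasing, and
would thus be a descent of `d'` at a step of `φ`, against the minimality of `d'`. Hence `v` has no
descents. -/
theorem cosetReps_eq {φ : Fin (m + 1) → α} (hφ : Monotone φ) {K : Finset (Fin m)}
    {d d' : Equiv.Perm (Fin (m + 1))} (hd : d ∈ cosetReps K (steps φ))
    (hd' : d' ∈ cosetReps K (steps φ)) (h : d⁻¹ * d' ∈ parabolic (steps φ)) : d = d' := by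
  rw [mem_parabolic_steps hφ] at h
  obtain ⟨v, rfl⟩ : ∃ v, d' = d * v := ⟨d⁻¹ * d', by group⟩
  rw [inv_mul_cancel_left] at h
  suffices hv : v = 1 by rw [hv, mul_one]
  apply eq_one_of_ascents
  by_contra! hc
  obtain ⟨r, hr⟩ := hc
  have hr' : v r.succ < v r.castSucc := (apply_lt_or_gt v r).resolve_left hr.not_gt
  have hφr : φ r.castSucc = φ r.succ := by
    refine le_antisymm (hφ Fin.castSucc_lt_succ.le) ?_
    rw [← h r.succ, ← h r.castSucc]
    exact hφ hr
  have h1 := lt_of_ascents hφ (fun r hr => lt_of_mem_cosetReps hd hr) hr'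
    (by rw [h, h, hφr])
  exact absurd (lt_of_mem_cosetReps hd' (mem_steps.2 hφr)) h1.not_gt

theorem exists_cosetRep {K J : Finset (Fin m)} (hJK : parabolic J ≤ parabolic K)
    {w : Equiv.Perm (Fin (m + 1))} (hw : w ∈ parabolic K) :
    ∃ d ∈ cosetReps K J, ∃ v ∈ parabolic J, w = d * v := by
  classical
  obtain ⟨v, hv, hmin⟩ := Finset.exists_min_image
    (Finset.univ.filter fun v => v ∈ parabolic J) (fun v => len (w * v))
    ⟨1, by simp [one_mem]⟩
  rw [Finset.mem_filter] at hv
  refine ⟨w * v, ?_, v⁻¹, inv_mem hv.2, by group⟩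
  rw [mem_cosetReps]
  refine ⟨mul_mem hw (hJK hv.2), fun x hx => ?_⟩
  rw [mul_assoc]
  exact hmin _ (by simpa using mul_mem hv.2 hx)

theorem steps_const : steps (fun _ : Fin (m + 1) => ()) = Finset.univ := by
  simp [steps]

theorem mem_parabolic_univ (w : Equiv.Perm (Fin (m + 1))) :
    w ∈ parabolic (Finset.univ : Finset (Fin m)) := by
  rw [← steps_const, mem_parabolic_steps fun _ _ _ => le_rfl]
  exact fun _ => rfl

/-- Whether a position lies after `a`. -/
def side (a : Fin m) (j : Fin (m + 1)) : Bool := decide (a.castSucc < j)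

theorem side_monotone (a : Fin m) : Monotone (side a) := by
  intro j l hjl
  rw [Bool.le_iff_imp]
  simp only [side, decide_eq_true_eq]
  exact fun h => h.trans_le hjl

theorem steps_side (a : Fin m) : steps (side a) = Finset.univ.erase a := by
  ext r
  rw [mem_steps, Finset.mem_erase]
  simp only [side, decide_eq_decide, Fin.lt_def, Fin.val_castSucc, Fin.val_succ, Finset.mem_univ,
    and_true, ne_eq, Fin.ext_iff]
  omega

end Parabolic

/-! ### Products along reduced words -/

section Matsumoto

variable {m : ℕ} {M : Type*} [Monoid M] {t : Fin m → M}

theorem s_comm {r p : Fin m} (h : (r : ℕ) + 1 < p) : s r * s p = s p * s r := by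
  have a1 : s r p.castSucc = p.castSucc :=
    s_of_ne _ _ (by simp [Fin.ext_iff]; omega) (by simp [Fin.ext_iff]; omega)
  have a2 : s r p.succ = p.succ :=
    s_of_ne _ _ (by simp [Fin.ext_iff]; omega) (by simp [Fin.ext_iff]; omega)
  have := Equiv.mul_swap_eq_swap_mul (s r) p.castSucc p.succ
  rw [a1, a2] at this
  exact this

theorem s_braid {r p : Fin m} (h : (r : ℕ) + 1 = p) :
    s r * s p * s r = s p * s r * s p := by
  have e : p.castSucc = r.succ := by simp [Fin.ext_iff]; omega
  have a2 : s r p.succ = p.succ :=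
    s_of_ne _ _ (by simp [Fin.ext_iff]; omega) (by simp [Fin.ext_iff]; omega)
  have a3 : s p r.castSucc = r.castSucc :=
    s_of_ne _ _ (by simp [Fin.ext_iff]; omega) (by simp [Fin.ext_iff]; omega)
  have a5 : s p p.succ = r.succ := by rw [← e]; exact s_succ p
  have h1 := Equiv.mul_swap_eq_swap_mul (s p * s r) p.castSucc p.succ
  rw [Equiv.Perm.mul_apply, e, s_succ, a3, Equiv.Perm.mul_apply, a2, a5] at h1
  rw [show Equiv.swap r.succ p.succ = s p by rw [← e]; rfl] at h1
  change s p * s r * s p = s r * (s p * s r) at h1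
  rw [h1, mul_assoc]

theorem gt_of_len_s_mul {w : Equiv.Perm (Fin (m + 1))} {r : Fin m}
    (h : len (s r * w) < len w) : w⁻¹ r.succ < w⁻¹ r.castSucc := by
  refine (apply_lt_or_gt w⁻¹ r).resolve_left fun h1 => ?_
  rw [len_s_mul h1] at h
  omega

theorem s_mul_s_mul (w : Equiv.Perm (Fin (m + 1))) (r : Fin m) : s r * (s r * w) = w := by
  rw [← mul_assoc, s_mul_self, one_mul]

/-- The inductive step of Matsumoto's theorem for words starting with different letters. When `r`
and `p` are both left descents, `w` has reduced words beginning with either side of the commutation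
or braid relation between them and continuing with a common word `c`. The induction hypothesis
compares each given word with one of these. -/
theorem prod_eq_of_reduced_aux
    (hcomm : ∀ r p : Fin m, (r : ℕ) + 1 < p → t r * t p = t p * t r)
    (hbraid : ∀ r p : Fin m, (r : ℕ) + 1 = p → t r * t p * t r = t p * t r * t p) {n : ℕ}
    (ih : ∀ (w : Equiv.Perm (Fin (m + 1))) (l l' : List (Fin m)), len w = n →
      (l.map s).prod = w → l.length = n → (l'.map s).prod = w → l'.length = n →
      (l.map t).prod = (l'.map t).prod)
    {w : Equiv.Perm (Fin (m + 1))} (hw : len w = n + 1) {r p : Fin m} {a b : List (Fin m)}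
    (hrp : (r : ℕ) < p) (ha : (a.map s).prod = s r * w) (hb : (b.map s).prod = s p * w)
    (han : a.length = n) (hbn : b.length = n)
    (dr : w⁻¹ r.succ < w⁻¹ r.castSucc) (dp : w⁻¹ p.succ < w⁻¹ p.castSucc) :
    t r * (a.map t).prod = t p * (b.map t).prod := by
  have lr := len_s_mul_of_gt dr
  have lp := len_s_mul_of_gt dp
  rcases Nat.lt_or_ge ((r : ℕ) + 1) p with h | h
  · have h1 : len (s p * (s r * w)) + 1 = len (s r * w) := by
      apply len_s_mul_of_gt
      rw [mul_inv_rev, s_inv, Equiv.Perm.mul_apply, Equiv.Perm.mul_apply, s_of_ne, s_of_ne]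
      · exact dp
      all_goals simp [Fin.ext_iff]; omega
    obtain ⟨c, hc, hc'⟩ := exists_reducedWord (s p * (s r * w))
    have e1 := ih (s r * w) a (p :: c) (by omega) ha (by omega)
      (by rw [List.map_cons, List.prod_cons, hc, s_mul_s_mul]) (by rw [List.length_cons]; omega)
    have e2 := ih (s p * w) b (r :: c) (by omega) hb (by omega)
      (by rw [List.map_cons, List.prod_cons, hc, ← mul_assoc (s p), ← s_comm h, mul_assoc,
        s_mul_s_mul])
      (by rw [List.length_cons]; omega)
    rw [e1, e2, List.map_cons, List.prod_cons, List.map_cons, List.prod_cons, ← mul_assoc,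
      ← mul_assoc, hcomm r p h]
  · have h : (r : ℕ) + 1 = p := by omega
    have e : p.castSucc = r.succ := by simp [Fin.ext_iff]; omega
    have a2 : s r p.succ = p.succ :=
      s_of_ne _ _ (by simp [Fin.ext_iff]; omega) (by simp [Fin.ext_iff]; omega)
    have a3 : s p r.castSucc = r.castSucc :=
      s_of_ne _ _ (by simp [Fin.ext_iff]; omega) (by simp [Fin.ext_iff]; omega)
    have a5 : s p r.succ = p.succ := by rw [← e]; exact s_castSucc p
    rw [e] at dp
    have h1 : len (s p * (s r * w)) + 1 = len (s r * w) := by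
      apply len_s_mul_of_gt
      rw [mul_inv_rev, s_inv, Equiv.Perm.mul_apply, Equiv.Perm.mul_apply, e, a2, s_succ]
      exact dp.trans dr
    have h2 : len (s r * (s p * (s r * w))) + 1 = len (s p * (s r * w)) := by
      apply len_s_mul_of_gt
      simp only [mul_inv_rev, s_inv, Equiv.Perm.mul_apply]
      rw [a3, a5, a2, s_castSucc]
      exact dp
    obtain ⟨c, hc, hc'⟩ := exists_reducedWord (s r * (s p * (s r * w)))
    have e1 := ih (s r * w) a (p :: r :: c) (by omega) ha (by omega)
      (by simp only [List.map_cons, List.prod_cons, hc, s_mul_s_mul])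
      (by simp only [List.length_cons]; omega)
    have hc2 : s r * (s p * (s r * w)) = s p * (s r * (s p * w)) := by
      have := congrArg (· * w) (s_braid h)
      simpa only [mul_assoc] using this
    have e2 := ih (s p * w) b (r :: p :: c) (by omega) hb (by omega)
      (by simp only [List.map_cons, List.prod_cons, hc, hc2, s_mul_s_mul])
      (by simp only [List.length_cons]; omega)
    rw [e1, e2]
    simp only [List.map_cons, List.prod_cons, ← mul_assoc]
    rw [hbraid r p h]

/-- The products of elements satisfying the braid relations along two reduced words of the same
permutation agree. -/
theorem prod_eq_of_reduced
    (hcomm : ∀ r p : Fin m, (r : ℕ) + 1 < p → t r * t p = t p * t r)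
    (hbraid : ∀ r p : Fin m, (r : ℕ) + 1 = p → t r * t p * t r = t p * t r * t p)
    (n : ℕ) : ∀ (w : Equiv.Perm (Fin (m + 1))) (l l' : List (Fin m)), len w = n →
      (l.map s).prod = w → l.length = n → (l'.map s).prod = w → l'.length = n →
      (l.map t).prod = (l'.map t).prod := by
  induction n using Nat.strong_induction_on with
  | _ n ih =>
    intro w l l' hw hl hln hl' hln'
    rcases l with - | ⟨r, a⟩
    · rw [List.length_nil] at hln
      rw [List.eq_nil_of_length_eq_zero (hln'.trans hln.symm)]
    rcases l' with - | ⟨p, b⟩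
    · rw [List.length_nil] at hln'
      rw [← hln', List.length_cons] at hln
      omega
    rw [List.length_cons] at hln hln'
    rw [List.map_cons, List.prod_cons] at hl hl'
    rw [List.map_cons, List.map_cons, List.prod_cons, List.prod_cons]
    have ha : (a.map s).prod = s r * w := by rw [← hl, s_mul_s_mul]
    have hb : (b.map s).prod = s p * w := by rw [← hl', s_mul_s_mul]
    have hra : len (s r * w) ≤ a.length := ha ▸ len_prod_le a
    have hpb : len (s p * w) ≤ b.length := hb ▸ len_prod_le b
    have dr := gt_of_len_s_mul (w := w) (r := r) (by omega)
    have dp := gt_of_len_s_mul (w := w) (r := p) (by omega)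
    have lr := len_s_mul_of_gt dr
    have lp := len_s_mul_of_gt dp
    clear hl hl' hra hpb
    have aux := @prod_eq_of_reduced_aux m M _ t hcomm hbraid (n - 1) (ih (n - 1) (by omega)) w
      (by omega)
    rcases lt_trichotomy (r : ℕ) p with h | h | h
    · exact aux h ha hb (by omega) (by omega) dr dp
    · obtain rfl : r = p := Fin.ext h
      rw [ih (n - 1) (by omega) (s r * w) a b (by omega) ha (by omega) hb (by omega)]
    · exact (aux h hb ha (by omega) (by omega) dp dr).symm

end Matsumoto

/-! ### Standard basis elements of the finite Hecke algebra -/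

section FiniteHecke

variable {k : Type*} [Field k] (q : kˣ) {m : ℕ}

theorem Tw_eq_prod {w : Equiv.Perm (Fin (m + 1))} {l : List (Fin m)} (h : (l.map s).prod = w)
    (hl : l.length = len w) : Tw q w = (l.map (hT q)).prod := by
  obtain ⟨h1, h2⟩ := (exists_reducedWord w).choose_spec
  exact prod_eq_of_reduced (hT_comm q) (hT_braid q) (len w) w _ l rfl h1 h2 h hl

theorem Tw_one : Tw q (1 : Equiv.Perm (Fin (m + 1))) = 1 :=
  Tw_eq_prod q (l := []) rfl len_one.symm

theorem Tw_mul_s {w : Equiv.Perm (Fin (m + 1))} {r : Fin m} (h : w r.castSucc < w r.succ) :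
    Tw q (w * s r) = Tw q w * hT q r := by
  obtain ⟨l, hl, hl'⟩ := exists_reducedWord w
  rw [Tw_eq_prod q hl hl', Tw_eq_prod q (l := l ++ [r])]
  · simp
  · simp [hl]
  · simp [hl', len_mul_s h]

theorem Tw_s_mul {w : Equiv.Perm (Fin (m + 1))} {r : Fin m}
    (h : w⁻¹ r.castSucc < w⁻¹ r.succ) : Tw q (s r * w) = hT q r * Tw q w := by
  obtain ⟨l, hl, hl'⟩ := exists_reducedWord w
  rw [Tw_eq_prod q hl hl', Tw_eq_prod q (l := r :: l)]
  · simp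
  · simp [hl]
  · simp [hl', len_s_mul h]

/-- Build `v` by ascents inside fibres of `φ`: since `d` is increasing on fibres, each of them is
also an ascent of the product with `d`, so the lengths add. -/
theorem Tw_mul {α : Type*} [LinearOrder α] {φ : Fin (m + 1) → α} (hφ : Monotone φ)
    {d : Equiv.Perm (Fin (m + 1))} (hd : ∀ r ∈ steps φ, d r.castSucc < d r.succ)
    {v : Equiv.Perm (Fin (m + 1))} (hv : v ∈ parabolic (steps φ)) :
    Tw q (d * v) = Tw q d * Tw q v := by
  rw [mem_parabolic_steps hφ] at hv
  refine stabilizer_induction hφ (P := fun v => Tw q (d * v) = Tw q d * Tw q v) ?_ ?_ v hv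
  · rw [mul_one, Tw_one, mul_one]
  · intro w r hw hr h ih
    have h1 : (d * w) r.castSucc < (d * w) r.succ := lt_of_ascents hφ hd h (by rw [hw, hw, hr])
    rw [← mul_assoc, Tw_mul_s q h1, Tw_mul_s q h, ih, mul_assoc]

open Classical in
/-- The elements of a parabolic subgroup. -/
def parabolicFinset (J : Finset (Fin m)) : Finset (Equiv.Perm (Fin (m + 1))) :=
  Finset.univ.filter fun w => w ∈ parabolic J

theorem mem_parabolicFinset {J : Finset (Fin m)} {w : Equiv.Perm (Fin (m + 1))} :
    w ∈ parabolicFinset J ↔ w ∈ parabolic J := by simp [parabolicFinset]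

theorem parabolicFinset_univ :
    parabolicFinset (Finset.univ : Finset (Fin m)) = Finset.univ := by
  ext w
  simp [mem_parabolicFinset, mem_parabolic_univ]

theorem vHash_eq (J : Finset (Fin m)) :
    vHash q J = hash q (∑ w ∈ parabolicFinset J, Tw q w) := by
  rw [map_sum]; rfl

theorem sum_cosetReps {α : Type*} [LinearOrder α] {φ : Fin (m + 1) → α} (hφ : Monotone φ)
    {K : Finset (Fin m)} (hK : parabolic (steps φ) ≤ parabolic K) {M : Type*} [AddCommMonoid M]
    (f : Equiv.Perm (Fin (m + 1)) → M) :
    ∑ w ∈ parabolicFinset K, f w =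
      ∑ d ∈ cosetReps K (steps φ), ∑ v ∈ parabolicFinset (steps φ), f (d * v) := by
  rw [← Finset.sum_product']
  symm
  refine Finset.sum_bij (fun p _ => p.1 * p.2) ?_ ?_ ?_ fun _ _ => rfl
  · rintro ⟨d, v⟩ h
    rw [Finset.mem_product, mem_parabolicFinset] at h
    exact mem_parabolicFinset.2 (mul_mem (mem_parabolic_of_mem_cosetReps h.1) (hK h.2))
  · rintro ⟨d, v⟩ h ⟨d', v'⟩ h' e
    rw [Finset.mem_product, mem_parabolicFinset] at h h'
    change d * v = d' * v' at e
    obtain rfl : d = d' := by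
      refine cosetReps_eq hφ h.1 h'.1 ?_
      rw [show d⁻¹ * d' = v * v'⁻¹ by rw [inv_mul_eq_iff_eq_mul, ← mul_assoc, e]; group]
      exact mul_mem h.2 (inv_mem h'.2)
    rw [mul_left_cancel e]
  · intro w hw
    obtain ⟨d, hd, v, hv, rfl⟩ := exists_cosetRep hK (mem_parabolicFinset.1 hw)
    exact ⟨(d, v), Finset.mem_product.2 ⟨hd, mem_parabolicFinset.2 hv⟩, rfl⟩

/-- This provides the left multiplier that realises the basis element of the Schur algebra. -/
theorem vHash_univ_eq {α : Type*} [LinearOrder α] {φ : Fin (m + 1) → α} (hφ : Monotone φ) :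
    vHash q (Finset.univ : Finset (Fin m)) =
      hash q (∑ d ∈ cosetReps Finset.univ (steps φ), Tw q d) * vHash q (steps φ) := by
  rw [vHash_eq, vHash_eq, ← map_mul, sum_cosetReps hφ fun w _ => mem_parabolic_univ w,
    Finset.sum_mul]
  simp only [Finset.mul_sum]
  congr 1
  refine Finset.sum_congr rfl fun d hd => Finset.sum_congr rfl fun v hv => ?_
  exact Tw_mul q hφ (fun r hr => lt_of_mem_cosetReps hd hr) (mem_parabolicFinset.1 hv)

/-- `W_J` splits into pairs `w`, `s_r w`; in each pair the shorter element `w` satisfies `T_{s_r w}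
= T_r T_w`. The cofactor is the sum over the shorter elements. -/
theorem sum_Tw_eq {J : Finset (Fin m)} {r : Fin m} (hr : r ∈ J) :
    ∃ y, ∑ w ∈ parabolicFinset J, Tw q w = (1 + hT q r) * y := by
  refine ⟨∑ w ∈ (parabolicFinset J).filter (fun w => w⁻¹ r.castSucc < w⁻¹ r.succ), Tw q w, ?_⟩
  rw [← Finset.sum_filter_add_sum_filter_not _ fun w => w⁻¹ r.castSucc < w⁻¹ r.succ, add_mul,
    one_mul, Finset.mul_sum]
  congr 1
  have hJ : ∀ w, s r * w ∈ parabolicFinset J ↔ w ∈ parabolicFinset J := fun w => by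
    rw [mem_parabolicFinset, mem_parabolicFinset]
    exact Subgroup.mul_mem_cancel_left _ (s_mem_parabolic hr)
  refine Finset.sum_bij' (fun w _ => s r * w) (fun w _ => s r * w) ?_ ?_ ?_ ?_ ?_
  · intro w hw
    rw [Finset.mem_filter] at hw
    rw [Finset.mem_filter, hJ]
    refine ⟨hw.1, ?_⟩
    simp only [mul_inv_rev, s_inv, Equiv.Perm.mul_apply, s_castSucc, s_succ]
    exact (apply_lt_or_gt w⁻¹ r).resolve_left hw.2
  · intro w hw
    rw [Finset.mem_filter] at hw
    rw [Finset.mem_filter, hJ]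
    refine ⟨hw.1, ?_⟩
    simp only [mul_inv_rev, s_inv, Equiv.Perm.mul_apply, s_castSucc, s_succ]
    exact hw.2.not_gt
  · exact fun w _ => s_mul_s_mul w r
  · exact fun w _ => s_mul_s_mul w r
  · intro w hw
    rw [Finset.mem_filter] at hw
    rw [← Tw_s_mul, s_mul_s_mul]
    simp only [mul_inv_rev, s_inv, Equiv.Perm.mul_apply, s_castSucc, s_succ]
    exact (apply_lt_or_gt w⁻¹ r).resolve_left hw.2

theorem hash_hT (r : Fin m) : hash q (hT q r) = algebraMap k _ (q - 1 : k) - hT q r := by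
  simp [hash, hT, hashGen]

theorem hT_mul_one_add (r : Fin m) :
    hT q r * (1 + hT q r) = algebraMap k _ (q : k) * (1 + hT q r) := by
  rw [mul_add, hT_quad, map_sub, map_one, mul_one, sub_mul, one_mul, mul_add, mul_one]
  abel

theorem hash_hT_mul_vHash {J : Finset (Fin m)} {r : Fin m} (hr : r ∈ J) :
    hash q (hT q r) * vHash q J = (q : k) • vHash q J := by
  obtain ⟨y, hy⟩ := sum_Tw_eq q hr
  rw [vHash_eq, hy, ← map_mul, ← mul_assoc, hT_mul_one_add, mul_assoc, ← Algebra.smul_def, map_smul]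

theorem doubleCosetOne_univ (J : Finset (Fin m)) : doubleCosetOne Finset.univ J = Finset.univ := by
  classical
  ext w
  simp only [doubleCosetOne, Finset.mem_filter, Finset.mem_univ, true_and, iff_true]
  exact ⟨w, mem_parabolic_univ w, 1, one_mem _, (mul_one w).symm⟩

theorem sum_hash_Tw_doubleCosetOne (J : Finset (Fin m)) :
    ∑ w ∈ doubleCosetOne Finset.univ J, hash q (Tw q w) = vHash q Finset.univ := by
  rw [doubleCosetOne_univ, vHash_eq, parabolicFinset_univ, map_sum]

end FiniteHecke

/-! ### The basis element of the completed Schur algebra -/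

section BasisElement

variable {k : Type*} [Field k] {q : kˣ} {m : ℕ} {i : Fin (m + 1) → Residue q}

/-- Left multiplication by an element which sends `v_J^♯` to `v_K^♯`. -/
def mulLeftVIdeal {J K : Finset (Fin m)} (h : HeckeHat i)
    (hh : h * toHat i (vHash q J) = toHat i (vHash q K)) :
    vIdeal i J →ₗ[(HeckeHat i)ᵐᵒᵖ] vIdeal i K where
  toFun x := ⟨h * x.1, by
    obtain ⟨c, hc⟩ := Submodule.mem_span_singleton.1 x.2
    rw [← hc, MulOpposite.smul_eq_mul_unop, ← mul_assoc, hh]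
    exact Submodule.mem_span_singleton.2 ⟨c, MulOpposite.smul_eq_mul_unop _ _⟩⟩
  map_add' x y := Subtype.ext (mul_add _ _ _)
  map_smul' c x := Subtype.ext (by
    change h * (c • (x : HeckeHat i)) = c • (h * (x : HeckeHat i))
    rw [MulOpposite.smul_eq_mul_unop, MulOpposite.smul_eq_mul_unop, mul_assoc])

/-- By right linearity an endomorphism is determined on the summand of `J` by its value at the
generator `v_J^♯`. -/
theorem IsBasisOne.unique {K J : Finset (Fin m)} {φ ψ : SchurHat i} (hφ : IsBasisOne K J φ)
    (hψ : IsBasisOne K J ψ) : φ = ψ := by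
  refine LinearMap.pi_ext fun L x => ?_
  by_cases hL : L = J
  · subst hL
    obtain ⟨c, hc⟩ := Submodule.mem_span_singleton.1 x.2
    have hx : x = c • vGen i L := Subtype.ext hc.symm
    rw [hx, Pi.single_smul, map_smul, map_smul]
    congr 1
    funext N
    exact Subtype.ext ((hφ.1 N).trans (hψ.1 N).symm)
  · rw [hφ.2 L hL, hψ.2 L hL]

theorem exists_isBasisOne {J : Finset (Fin m)} {h : HeckeHat i}
    (hh : h * toHat i (vHash q J) = toHat i (vHash q Finset.univ)) :
    ∃ φ : SchurHat i, IsBasisOne Finset.univ J φ := by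
  refine ⟨(LinearMap.single _ _ Finset.univ).comp ((mulLeftVIdeal h hh).comp
    (LinearMap.proj (φ := fun J => vIdeal i J) J)), fun L => ?_, fun J' hJ' x => ?_⟩
  · rw [sum_hash_Tw_doubleCosetOne]
    rw [LinearMap.comp_apply, LinearMap.comp_apply, LinearMap.proj_apply, Pi.single_eq_same,
      LinearMap.single_apply]
    split_ifs with hL
    · subst hL
      rw [Pi.single_eq_same]
      exact hh
    · rw [Pi.single_eq_of_ne hL]
      rfl
  · rw [LinearMap.comp_apply, LinearMap.comp_apply, LinearMap.proj_apply,
      Pi.single_eq_of_ne hJ'.symm, map_zero, map_zero]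

/-- The components of the basis element are given by elements of the completed Hecke algebra. -/
theorem IsBasisOne.coeffHat_mul {J : Finset (Fin m)} {φ : SchurHat i} {h : HeckeHat i}
    (hh : h * toHat i (vHash q J) = toHat i (vHash q Finset.univ))
    (hφ : IsBasisOne Finset.univ J φ) (L : Finset (Fin m)) :
    coeffHat φ L J * toHat i (vHash q J) =
      if L = Finset.univ then toHat i (vHash q Finset.univ) else 0 := by
  have h1 := hφ.1 L
  rw [sum_hash_Tw_doubleCosetOne] at h1
  -- `coeffHat` falls back to its default `0` unless a multiplier exists. Here `h` is one for the
  -- full set, and `0` for every other `L`.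
  have h2 : ∃ x : HeckeHat i, (φ (Pi.single J (vGen i J)) L : HeckeHat i) =
      x * toHat i (vHash q J) := by
    rw [h1]
    split_ifs
    · exact ⟨h, hh.symm⟩
    · exact ⟨0, (zero_mul _).symm⟩
  rw [← h1, coeffHat, dif_pos h2]
  exact h2.choose_spec.symm

end BasisElement

/-! ### Twisted combinations of permutations on fractions -/

section SkewOperators

variable {k : Type*} [Field k] {q : kˣ} {m : ℕ} {i : Fin (m + 1) → Residue q}

theorem permF_one (f : FracRep i) : permF 1 f = f := by
  rcases Nat.eq_zero_or_pos m with rfl | hm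
  · funext u
    rw [permF_apply, inv_one, one_smul]
    obtain ⟨a, b, hb, h⟩ := IsFractionRing.div_surjective (A := PS k 0) (f u)
    rw [← h, map_div₀, permFrac_algebraMap, permFrac_algebraMap, permPS_one, permPS_one]
  · rw [← s_mul_self (⟨0, hm⟩ : Fin m), ← permF_permF, permF_s_s]

theorem permF_inv_permF (w : Equiv.Perm (Fin (m + 1))) (f : FracRep i) :
    permF w⁻¹ (permF w f) = f := by
  rw [permF_permF, inv_mul_cancel, permF_one]

/-- The operator `∑_v c_v v` on fractions. -/
def skewOp (c : Equiv.Perm (Fin (m + 1)) → FracRep i) (f : FracRep i) : FracRep i :=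
  ∑ v, c v * permF v f

theorem permF_theta (w : Equiv.Perm (Fin (m + 1))) (j l : Fin (m + 1)) :
    permF w (theta i j l) = theta i (w j) (w l) := by
  simp only [theta, permF_div, map_sub, map_mul, permF_qF, permF_XF]

/-- The constant term of `q X_j - X_l` may vanish at `u`, but its coefficient at the local
coordinate of `X_l` is `-1`. -/
theorem theta_ne_zero {j l : Fin (m + 1)} (h : j ≠ l) (u : Orb i) : theta i j l u ≠ 0 := by
  classical
  refine div_ne_zero ?_ (XF_sub_ne l j h.symm u)
  intro h0
  have h1 : (algebraMap k (PolyRep i) (q : k) * Xel i j - Xel i l) u = 0 := by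
    apply IsFractionRing.injective (PS k m) (PSFrac k m)
    rw [map_zero, ← h0]
    change _ = (toFrac (algebraMap k (PolyRep i) (q : k)) * toFrac (Xel i j) - toFrac (Xel i l)) u
    rw [← map_mul, ← map_sub]
    rfl
  have h2 : MvPowerSeries.C (q : k) * Xel i j u - Xel i l u = 0 := h1
  have h3 := congrArg (MvPowerSeries.coeff (Finsupp.single l 1)) h2
  simp [Xel, MvPowerSeries.coeff_C, MvPowerSeries.coeff_X, Finsupp.single_left_inj,
    h.symm, mul_add, MvPowerSeries.coeff_C_mul] at h3

/-- Dedekind's independence of characters: for fixed `u` the maps `f ↦ (w f)(u)` are multiplicative,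
and they are pairwise distinct because they already differ on some `X_j`. -/
theorem skewOp_linearIndependent {c : Equiv.Perm (Fin (m + 1)) → FracRep i}
    (h : ∀ f : PolyRep i, skewOp c (toFrac f) = 0) : c = 0 := by
  have key : ∀ u : Orb i, ∀ v, c v u = 0 := by
    intro u
    let χ : Equiv.Perm (Fin (m + 1)) → (PolyRep i →* PSFrac k m) := fun w =>
      (((Pi.evalRingHom _ u).comp (permF w)).comp toFrac : PolyRep i →+* PSFrac k m)
    have hχ : Function.Injective χ := by
      intro w w' hw
      ext j
      by_contra hne
      have h1 : permF w (XF i j) u = permF w' (XF i j) u := DFunLike.congr_fun hw (Xel i j)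
      rw [permF_XF, permF_XF] at h1
      refine XF_sub_ne (w' j) (w j) (fun e => hne (by rw [e])) u ?_
      rw [h1, sub_self]
    have h2 := (linearIndependent_monoidHom (PolyRep i) (PSFrac k m)).comp χ hχ
    rw [Fintype.linearIndependent_iff] at h2
    apply h2 (fun v => c v u)
    funext f
    have h3 := congrFun (h f) u
    simpa [skewOp, Finset.sum_apply, χ] using h3
  funext v u
  exact key u v

theorem skewOp_injective {c c' : Equiv.Perm (Fin (m + 1)) → FracRep i}
    (h : ∀ f : PolyRep i, skewOp c (toFrac f) = skewOp c' (toFrac f)) : c = c' := by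
  rw [← sub_eq_zero]
  refine skewOp_linearIndependent fun f => ?_
  have h1 := sub_eq_zero.2 (h f)
  rw [← h1]
  simp only [skewOp, Pi.sub_apply, sub_mul, Finset.sum_sub_distrib]

theorem permF_skewOp (w : Equiv.Perm (Fin (m + 1)))
    (c : Equiv.Perm (Fin (m + 1)) → FracRep i) (f : FracRep i) :
    permF w (skewOp c f) = skewOp (fun v => permF w (c (w⁻¹ * v))) f := by
  rw [skewOp, skewOp, map_sum]
  refine Fintype.sum_equiv (Equiv.mulLeft w) _ _ fun v => ?_
  simp [permF_permF]

end SkewOperators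

/-! ### The symmetrisers in the polynomial representation -/

section Symmetrisers

variable {k : Type*} [Field k] {q : kˣ} {m : ℕ} {i : Fin (m + 1) → Residue q}

theorem heckeRep_hT (r : Fin m) (f : PolyRep i) : heckeRep i (hT q r) f = opT r f := by
  simp [heckeRep, hT, opGen]

theorem heckeRep_hX (j : Fin (m + 1)) (f : PolyRep i) :
    heckeRep i (hX q j) f = Xel i j * f := by
  simp [heckeRep, hX, opGen]

theorem heckeRep_hXinv (j : Fin (m + 1)) (f : PolyRep i) :
    heckeRep i (hXinv q j) f = Xinvel i j * f := by
  simp [heckeRep, hXinv, opGen]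

/-- The `s_r`-invariants are the eigenvectors of `T_r` for `-1`; the twist turns this eigenvalue
into `q` and makes `θ_{r+1,r}` the coefficient of `s_r`. -/
theorem toFrac_hash_hT (r : Fin m) (f : PolyRep i) :
    toFrac (heckeRep i (hash q (hT q r)) f) =
      (qF i - theta i r.succ r.castSucc) * toFrac f +
        theta i r.succ r.castSucc * permF (s r) (toFrac f) := by
  rw [hash_hT, map_sub, AlgHom.commutes, LinearMap.sub_apply, Module.algebraMap_end_apply,
    heckeRep_hT, map_sub, toFrac_opT, sub_smul, one_smul, map_sub, toFrac_algebraMap_mul, theta]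
  ring

/-- Multiply out the two-term operators `T_r^♯` along a reduced word. Choosing `s_r` in every factor
yields `w` with a product of `θ`s as coefficient; every other choice yields a shorter permutation,
still in the stabiliser of `φ`. -/
theorem exists_skewOp_Tw (w : Equiv.Perm (Fin (m + 1))) {α : Type*} [LinearOrder α]
    {φ : Fin (m + 1) → α} (hφ : Monotone φ) (hw : ∀ j, φ (w j) = φ j) :
    ∃ c : Equiv.Perm (Fin (m + 1)) → FracRep i,
      (∀ f, toFrac (heckeRep i (hash q (Tw q w)) f) = skewOp c (toFrac f)) ∧
      (∀ v, c v ≠ 0 → (∀ j, φ (v j) = φ j) ∧ (v = w ∨ len v < len w)) ∧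
      c w = ∏ p ∈ inversions w⁻¹, theta i p.2 p.1 := by
  classical
  -- The induction adds letters on the right, whereas here the new factor `T_r` acts last and stands
  -- on the left; hence the passage to inverses.
  obtain ⟨x, rfl⟩ : ∃ x, w = x⁻¹ := ⟨w⁻¹, (inv_inv w).symm⟩
  have hx : ∀ j, φ (x j) = φ j := fun j => by simpa using (hw (x j)).symm
  clear hw
  refine stabilizer_induction hφ ?_ ?_ x hx
  · refine ⟨fun v => if v = 1 then 1 else 0, fun f => ?_, fun v hv => ?_, ?_⟩
    · simp only [skewOp, ite_mul, one_mul, zero_mul, Finset.sum_ite_eq', Finset.mem_univ, if_true,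
        permF_one, inv_one, Tw_one, map_one, Module.End.one_apply]
    · have : v = 1 := by by_contra h; simp [h] at hv
      subst this
      simp
    · have : inversions (1 : Equiv.Perm (Fin (m + 1))) = ∅ := by
        rw [← Finset.card_eq_zero, ← len_eq_card_inversions, len_one]
      simp [this]
  · intro x r hx hr hlt ih
    obtain ⟨c, hc1, hc2, hc3⟩ := ih
    have hlt' : x⁻¹⁻¹ r.castSucc < x⁻¹⁻¹ r.succ := by simpa using hlt
    have hlen := len_s_mul hlt'
    rw [mul_inv_rev, s_inv]
    have hsupp : ∀ v, c (s r * v) ≠ 0 →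
        (∀ j, φ (v j) = φ j) ∧ (v = s r * x⁻¹ ∨ len v < len (s r * x⁻¹)) := by
      intro v hv
      obtain ⟨h1, h2⟩ := hc2 _ hv
      refine ⟨fun j => ?_, ?_⟩
      · have := h1 j
        rwa [Equiv.Perm.mul_apply, apply_s_of_eq hr] at this
      · rcases h2 with h2 | h2
        · left
          rw [← h2, s_mul_s_mul]
        · right
          rcases apply_lt_or_gt v⁻¹ r with h3 | h3
          · have := len_s_mul h3; omega
          · have := len_s_mul_of_gt h3; omega
    refine ⟨fun v => (qF i - theta i r.succ r.castSucc) * c v +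
      theta i r.succ r.castSucc * permF (s r) (c (s r * v)), fun f => ?_, fun v hv => ?_, ?_⟩
    · rw [Tw_s_mul q hlt', map_mul, map_mul, Module.End.mul_apply, toFrac_hash_hT, hc1,
        permF_skewOp, s_inv]
      simp only [skewOp, Finset.mul_sum, add_mul, Finset.sum_add_distrib, mul_assoc]
    · by_cases h1 : c (s r * v) = 0
      · have h2 : c v ≠ 0 := by
          intro h2
          simp [h1, h2] at hv
        obtain ⟨h3, h4⟩ := hc2 _ h2
        refine ⟨h3, Or.inr ?_⟩
        rcases h4 with rfl | h4 <;> omega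
      · exact hsupp v h1
    -- The new permutation is longer than `x⁻¹`, hence outside the old support, so only the `s_r`
    -- term reaches the leading coefficient.
    · have h0 : c (s r * x⁻¹) = 0 := by
        by_contra h1
        rcases (hc2 _ h1).2 with h2 | h2
        · rw [h2] at hlen; omega
        · omega
      dsimp only
      rw [h0, mul_zero, zero_add, s_mul_s_mul, hc3, mul_inv_rev, inv_inv, s_inv, map_prod,
        prod_inversions_mul_s hlt]
      simp only [permF_theta]

/-- The product of the `theta i j l` over the pairs `j < l` in the same fibre of `φ`. -/
def thetaProd (i : Fin (m + 1) → Residue q) {α : Type*} [LinearOrder α] (φ : Fin (m + 1) → α) :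
    FracRep i :=
  ∏ p ∈ Finset.univ.filter (fun p : Fin (m + 1) × Fin (m + 1) => p.1 < p.2 ∧ φ p.1 = φ p.2),
    theta i p.1 p.2

theorem thetaProd_ne_zero {α : Type*} [LinearOrder α] (φ : Fin (m + 1) → α) (u : Orb i) :
    thetaProd i φ u ≠ 0 := by
  rw [thetaProd, Finset.prod_apply]
  exact Finset.prod_ne_zero_iff.2 fun p hp => theta_ne_zero (Finset.mem_filter.1 hp).2.1.ne u

/-- Elements in the image of `v_J^♯` are invariant. -/
theorem permF_toFrac_vHash {J : Finset (Fin m)} {r : Fin m} (hr : r ∈ J) (f : PolyRep i) :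
    permF (s r) (toFrac (heckeRep i (vHash q J) f)) = toFrac (heckeRep i (vHash q J) f) := by
  have h1 := congrArg (fun x => toFrac (heckeRep i x f)) (hash_hT_mul_vHash q hr)
  simp only [map_mul, Module.End.mul_apply, toFrac_hash_hT, map_smul, LinearMap.smul_apply,
    toFrac_algebraMap_mul] at h1
  funext u
  have h2 := congrFun h1 u
  have h3 := theta_ne_zero (i := i) (castSucc_ne_succ r).symm u
  simp only [Pi.add_apply, Pi.mul_apply, Pi.sub_apply] at h2
  apply mul_left_cancel₀ h3
  linear_combination h2

theorem coeff_mul_of_invariant {J : Finset (Fin m)} {c : Equiv.Perm (Fin (m + 1)) → FracRep i}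
    (hc : ∀ r ∈ J, ∀ v, c (s r * v) = permF (s r) (c v)) {w : Equiv.Perm (Fin (m + 1))}
    (hw : w ∈ parabolic J) (v : Equiv.Perm (Fin (m + 1))) : c (w * v) = permF w (c v) := by
  induction hw using Subgroup.closure_induction generalizing v with
  | mem x hx =>
    obtain ⟨r, hr, rfl⟩ := hx
    exact hc r hr v
  | one => rw [one_mul, permF_one]
  | mul x y _ _ hx hy => rw [mul_assoc, hx, hy, permF_permF]
  | inv x _ hx =>
    have h := hx (x⁻¹ * v)
    rw [mul_inv_cancel_left] at h
    rw [h, permF_inv_permF]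

/-- An element of maximal length descends at every step of `φ`, and therefore reverses each pair
lying in one fibre. -/
theorem exists_longest {α : Type*} [LinearOrder α] {φ : Fin (m + 1) → α} (hφ : Monotone φ) :
    ∃ w₀ ∈ parabolic (steps φ), (∀ w ∈ parabolic (steps φ), len w ≤ len w₀) ∧
      inversions w₀ = Finset.univ.filter fun p => p.1 < p.2 ∧ φ p.1 = φ p.2 := by
  obtain ⟨w₀, h0, hmax⟩ := Finset.exists_max_image (parabolicFinset (steps φ)) len
    ⟨1, mem_parabolicFinset.2 (one_mem _)⟩
  rw [mem_parabolicFinset] at h0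
  simp only [mem_parabolicFinset] at hmax
  refine ⟨w₀, h0, hmax, ?_⟩
  have hφ0 := (mem_parabolic_steps hφ).1 h0
  have hdesc : ∀ r ∈ steps φ, OrderDual.toDual (w₀ r.castSucc) < OrderDual.toDual (w₀ r.succ) := by
    intro r hr
    refine (apply_lt_or_gt w₀ r).resolve_left fun h => ?_
    have h1 := hmax _ (mul_mem h0 (s_mem_parabolic hr))
    rw [len_mul_s h] at h1
    omega
  ext ⟨a, b⟩
  rw [mem_inversions, Finset.mem_filter, and_iff_right (Finset.mem_univ _)]
  refine and_congr_right fun hab => ⟨fun h => ?_, fun h => ?_⟩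
  · refine le_antisymm (hφ hab.le) ?_
    rw [← hφ0 a, ← hφ0 b]
    exact hφ h.le
  · exact lt_of_ascents hφ hdesc hab h

/-- The action of `v_J^♯` is a weighted symmetrisation. -/
theorem toFrac_vHash {α : Type*} [LinearOrder α] {φ : Fin (m + 1) → α} (hφ : Monotone φ)
    (f : PolyRep i) : toFrac (heckeRep i (vHash q (steps φ)) f) =
      ∑ w ∈ parabolicFinset (steps φ), permF w (thetaProd i φ * toFrac f) := by
  classical
  have hmem : ∀ {w}, w ∈ parabolicFinset (steps φ) ↔ ∀ j, φ (w j) = φ j := fun {w} =>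
    mem_parabolicFinset.trans (mem_parabolic_steps hφ)
  choose! C hC1 hC2 hC3 using fun w (hw : ∀ j, φ (w j) = φ j) =>
    exists_skewOp_Tw (i := i) w hφ hw
  set c : Equiv.Perm (Fin (m + 1)) → FracRep i :=
    fun v => ∑ w ∈ parabolicFinset (steps φ), C w v with hc
  have hop : ∀ f, toFrac (heckeRep i (vHash q (steps φ)) f) = skewOp c (toFrac f) := by
    intro f
    rw [vHash_eq, map_sum, map_sum, LinearMap.sum_apply, map_sum]
    simp only [skewOp, hc, Finset.sum_mul]
    rw [Finset.sum_comm]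
    exact Finset.sum_congr rfl fun w hw => hC1 w (hmem.1 hw) f
  have hsupp : ∀ v, v ∉ parabolicFinset (steps φ) → c v = 0 := by
    intro v hv
    refine Finset.sum_eq_zero fun w hw => ?_
    by_contra h
    exact hv (hmem.2 (hC2 w (hmem.1 hw) v h).1)
  -- Applying `s_r` to the operator changes nothing, since its values are invariant; uniqueness of
  -- the coefficients turns this into an identity between them.
  have hinv : ∀ r ∈ steps φ, ∀ v, c (s r * v) = permF (s r) (c v) := by
    intro r hr v
    have h1 : (fun v => permF (s r) (c ((s r)⁻¹ * v))) = c := by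
      refine skewOp_injective fun f => ?_
      rw [← permF_skewOp, ← hop, permF_toFrac_vHash hr]
    have h2 := congrFun h1 (s r * v)
    simpa using h2.symm
  obtain ⟨w₀, h0, hmax, hinv0⟩ := exists_longest hφ
  -- By triangularity only `T_{w₀}` contributes to the coefficient of the longest element.
  have hc0 : c w₀ = ∏ p ∈ inversions w₀⁻¹, theta i p.2 p.1 := by
    rw [hc, ← hC3 w₀ ((mem_parabolic_steps hφ).1 h0)]
    refine Finset.sum_eq_single_of_mem _ (mem_parabolicFinset.2 h0) fun w hw hne => ?_
    by_contra h
    rcases (hC2 w (hmem.1 hw) _ h).2 with h1 | h1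
    · exact hne h1.symm
    · exact h1.not_ge (hmax _ (mem_parabolicFinset.1 hw))
  -- Translate the coefficient at `w₀` back by `w₀⁻¹`; this turns the inversions of `w₀⁻¹` into
  -- those of `w₀` with the two entries exchanged.
  have hc1 : c 1 = thetaProd i φ := by
    have h1 := coeff_mul_of_invariant hinv (inv_mem h0) w₀
    rw [inv_mul_cancel, hc0, map_prod] at h1
    rw [h1, thetaProd, ← hinv0]
    refine Finset.prod_nbij' (fun p => (w₀⁻¹ p.2, w₀⁻¹ p.1)) (fun p => (w₀ p.2, w₀ p.1))
      ?_ ?_ ?_ ?_ ?_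
    · intro p hp
      rw [mem_inversions] at hp ⊢
      simpa using hp.symm
    · intro p hp
      rw [mem_inversions] at hp ⊢
      simpa using hp.symm
    · intro p _
      simp
    · intro p _
      simp
    · intro p _
      rw [permF_theta]
  rw [hop, skewOp, ← Finset.sum_subset (Finset.subset_univ (parabolicFinset (steps φ)))
    fun v _ hv => by rw [hsupp v hv, zero_mul]]
  refine Finset.sum_congr rfl fun w hw => ?_
  rw [map_mul, ← hc1, ← coeff_mul_of_invariant hinv (mem_parabolicFinset.1 hw), mul_one]

end Symmetrisers

/-! ### Invariant elements and the adic filtration of the polynomial representation -/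

section Filtration

variable {k : Type*} [Field k] {q : kˣ} {m : ℕ} {i : Fin (m + 1) → Residue q}

theorem opT_mul_of_invariant {z : PolyRep i} (hz : ∀ w, perm w z = z) (r : Fin m)
    (f : PolyRep i) : opT r (z * f) = z * opT r f := by
  apply toFrac_injective
  rw [map_mul toFrac, toFrac_opT, toFrac_opT, map_mul toFrac, map_mul (permF _),
    permF_toFrac (s r) z, hz]
  ring

theorem heckeRep_mul_of_invariant {z : PolyRep i} (hz : ∀ w, perm w z = z) (h : Hecke q m)
    (f : PolyRep i) : heckeRep i h (z * f) = z * heckeRep i h f := by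
  obtain ⟨x, rfl⟩ := RingQuot.mkAlgHom_surjective k _ h
  induction x using FreeAlgebra.induction generalizing f with
  | grade0 c => simp only [AlgHom.commutes, Module.algebraMap_end_apply, mul_smul_comm]
  | grade1 g =>
    cases g with
    | T r =>
      change heckeRep i (hT q r) _ = _ * heckeRep i (hT q r) _
      rw [heckeRep_hT, heckeRep_hT, opT_mul_of_invariant hz]
    | X j =>
      change heckeRep i (hX q j) _ = _ * heckeRep i (hX q j) _
      rw [heckeRep_hX, heckeRep_hX, mul_left_comm]
    | Xinv j =>
      change heckeRep i (hXinv q j) _ = _ * heckeRep i (hXinv q j) _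
      rw [heckeRep_hXinv, heckeRep_hXinv, mul_left_comm]
  | mul a b ha hb =>
    rw [map_mul (RingQuot.mkAlgHom k _), map_mul (heckeRep i), Module.End.mul_apply,
      Module.End.mul_apply, hb, ha]
  | add a b ha hb => rw [map_add, map_add, LinearMap.add_apply, LinearMap.add_apply, ha, hb, mul_add]

variable (i) in
/-- The invariant elements without constant term. -/
def invariantsNoConst : Set (PolyRep i) :=
  {z | (∀ w, perm w z = z) ∧ ∀ u, MvPowerSeries.constantCoeff (z u) = 0}

variable (i) in
/-- The ideal generated by the invariant elements without constant term. -/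
def invariantIdeal : Ideal (PolyRep i) := Ideal.span (invariantsNoConst i)

theorem mul_mem_invariantIdeal_pow {z f : PolyRep i} (hz : z ∈ invariantsNoConst i) {n : ℕ}
    (hf : f ∈ invariantIdeal i ^ n) : z * f ∈ invariantIdeal i ^ (n + 1) := by
  rw [pow_succ']
  exact Ideal.mul_mem_mul (Ideal.subset_span hz) hf

/-- The Hecke algebra acts linearly over the invariants, which contain the generators of the ideal.
-/
theorem heckeRep_mem_invariantIdeal_pow (h : Hecke q m) {n : ℕ} {f : PolyRep i}
    (hf : f ∈ invariantIdeal i ^ n) : heckeRep i h f ∈ invariantIdeal i ^ n := by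
  induction n generalizing f with
  | zero => simp
  | succ n ih =>
    rw [pow_succ'] at hf
    induction hf using Submodule.mul_induction_on' with
    | mem_mul_mem a ha b hb =>
      induction ha using Submodule.span_induction generalizing b with
      | mem z hz =>
        rw [heckeRep_mul_of_invariant hz.1]
        exact mul_mem_invariantIdeal_pow hz (ih hb)
      | zero => simp
      | add x y _ _ hx hy =>
        rw [add_mul, map_add]
        exact add_mem (hx b hb) (hy b hb)
      | smul c x _ hx =>
        rw [smul_mul_assoc, ← mul_smul_comm]
        exact hx _ (Ideal.mul_mem_left _ c hb)
    | add x _ y _ hx hy =>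
      rw [map_add]
      exact add_mem hx hy

theorem le_order_of_mem_invariantIdeal_pow {n : ℕ} {f : PolyRep i}
    (hf : f ∈ invariantIdeal i ^ n) (u : Orb i) : (n : ℕ∞) ≤ (f u).order := by
  induction n generalizing f with
  | zero => simp
  | succ n ih =>
    rw [pow_succ'] at hf
    induction hf using Submodule.mul_induction_on' with
    | mem_mul_mem a ha b hb =>
      have ha1 : 1 ≤ (a u).order := by
        rw [MvPowerSeries.one_le_order_iff_constCoeff_eq_zero]
        induction ha using Submodule.span_induction with
        | mem z hz => exact hz.2 u
        | zero => exact map_zero _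
        | add x y _ _ hx hy => rw [Pi.add_apply, map_add, hx, hy, add_zero]
        | smul c x _ hx => rw [smul_eq_mul, Pi.mul_apply, map_mul, hx, mul_zero]
      refine le_trans ?_ MvPowerSeries.le_order_mul
      rw [Nat.cast_succ, add_comm]
      exact add_le_add ha1 (ih hb)
    | add x _ y _ hx hy => exact (le_min hx hy).trans MvPowerSeries.min_order_le_add

/-- The element `X_j` as a unit of the polynomial representation. -/
def XelUnit (i : Fin (m + 1) → Residue q) (j : Fin (m + 1)) : (PolyRep i)ˣ :=
  ⟨Xel i j, Xinvel i j, Xel_mul_inv j, by rw [mul_comm, Xel_mul_inv]⟩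

/-- The Laurent monomial in the polynomial representation. -/
def monomialUnit (i : Fin (m + 1) → Residue q) (α : Fin (m + 1) → ℤ) : (PolyRep i)ˣ :=
  ∏ j, XelUnit i j ^ α j

theorem heckeRep_laurentMonomial (α : Fin (m + 1) → ℤ) :
    heckeRep i (laurentMonomial q α) =
      LinearMap.mulLeft k (monomialUnit i α : PolyRep i) := by
  -- The exponents are integers, so the comparison is carried out between homomorphisms of unit
  -- groups.
  let ρ : (Hecke q m)ˣ →* (Module.End k (PolyRep i))ˣ := Units.map (heckeRep i : _ →* _)
  let μ : (PolyRep i)ˣ →* (Module.End k (PolyRep i))ˣ :=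
    Units.map (Algebra.lmul k (PolyRep i) : _ →* _)
  have hX : ∀ j, ρ (uX q j) = μ (XelUnit i j) := by
    intro j
    apply Units.ext
    apply LinearMap.ext
    intro f
    exact heckeRep_hX j f
  have h : ρ (List.ofFn fun j => uX q j ^ α j).prod = μ (monomialUnit i α) := by
    rw [monomialUnit, ← List.prod_ofFn, map_list_prod, map_list_prod, List.map_ofFn, List.map_ofFn]
    congr 2
    funext j
    simp only [Function.comp_apply, map_zpow, hX]
  exact congrArg Units.val h

theorem perm_monomialUnit (w : Equiv.Perm (Fin (m + 1))) (α : Fin (m + 1) → ℤ) :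
    perm w (monomialUnit i α : PolyRep i) = monomialUnit i (α ∘ (w⁻¹ : Equiv.Perm _)) := by
  have hX : ∀ j, Units.map (perm (i := i) w : PolyRep i →* PolyRep i) (XelUnit i j) =
      XelUnit i (w j) :=
    fun j => Units.ext (perm_Xel w j)
  have h : Units.map (perm (i := i) w : PolyRep i →* PolyRep i) (monomialUnit i α) =
      monomialUnit i (α ∘ (w⁻¹ : Equiv.Perm _)) := by
    rw [monomialUnit, map_prod, monomialUnit]
    refine Fintype.prod_equiv w _ _ fun j => ?_
    simp [hX]
  exact congrArg Units.val h

theorem constantCoeff_monomialUnit (u : Orb i) (α : Fin (m + 1) → ℤ) :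
    MvPowerSeries.constantCoeff ((monomialUnit i α : PolyRep i) u) =
      ∏ j, (((q ^ (u.1 j : ℤ)) ^ α j : kˣ) : k) := by
  let χ : PolyRep i →* k :=
    ((MvPowerSeries.constantCoeff : PS k m →+* k).comp (Pi.evalRingHom _ u) : PolyRep i →+* k)
  have hX : ∀ j, Units.map χ (XelUnit i j) = q ^ (u.1 j : ℤ) := by
    intro j
    apply Units.ext
    change MvPowerSeries.constantCoeff (Xel i j u) = _
    rw [Xel, map_add, MvPowerSeries.constantCoeff_C, MvPowerSeries.constantCoeff_X, add_zero]
  have h : Units.map χ (monomialUnit i α) = ∏ j, (q ^ (u.1 j : ℤ)) ^ α j := by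
    rw [monomialUnit, map_prod]
    exact Finset.prod_congr rfl fun j _ => by rw [map_zpow, hX]
  have h1 := congrArg Units.val h
  rw [Units.coe_prod] at h1
  exact h1

theorem constantCoeff_perm (w : Equiv.Perm (Fin (m + 1))) (f : PolyRep i) (u : Orb i) :
    MvPowerSeries.constantCoeff (perm w f u) = MvPowerSeries.constantCoeff (f (w⁻¹ • u)) := by
  rw [perm_apply, permPS_apply, MvPowerSeries.constantCoeff_rename]

theorem exists_smul_base (u : Orb i) :
    ∃ w : Equiv.Perm (Fin (m + 1)), w⁻¹ • u = (⟨i, 1, rfl⟩ : Orb i) := by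
  obtain ⟨w, hw⟩ := u.2
  refine ⟨w⁻¹, Subtype.ext ?_⟩
  funext j
  rw [smul_apply, hw]
  simp

/-- Symmetric Laurent polynomials in the kernel of the central character act by invariant elements
without constant term. -/
theorem heckeRep_centralKernel {x : Hecke q m} (hx : x ∈ centralKernel i) :
    ∃ z ∈ invariantsNoConst i, ∀ f, heckeRep i x f = z * f := by
  obtain ⟨p, hp1, hp2, rfl⟩ := hx
  have hinv : ∀ w, perm w (p.sum fun α c => c • (monomialUnit i α : PolyRep i)) =
      p.sum fun α c => c • (monomialUnit i α : PolyRep i) := by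
    intro w
    simp only [Finsupp.sum, map_sum, perm_smul, perm_monomialUnit]
    have hw : ∀ α : Fin (m + 1) → ℤ, p (α ∘ (w⁻¹ : Equiv.Perm _)) = p α := fun α => hp1 w⁻¹ α
    have c1 : ∀ α : Fin (m + 1) → ℤ, (α ∘ (w⁻¹ : Equiv.Perm _)) ∘ w = α := fun α => by
      funext j; simp
    have c2 : ∀ α : Fin (m + 1) → ℤ, (α ∘ w) ∘ (w⁻¹ : Equiv.Perm _) = α := fun α => by
      funext j; simp
    refine Finset.sum_nbij' (fun α => α ∘ (w⁻¹ : Equiv.Perm _)) (fun α => α ∘ w) ?_ ?_ ?_ ?_ ?_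
    · intro α hα
      rw [Finsupp.mem_support_iff] at hα ⊢
      rwa [hw]
    · intro α hα
      rw [Finsupp.mem_support_iff] at hα ⊢
      rwa [hp1]
    · exact fun α _ => c1 α
    · exact fun α _ => c2 α
    · intro α _
      rw [hw]
  refine ⟨p.sum fun α c => c • (monomialUnit i α : PolyRep i), ⟨hinv, fun u => ?_⟩, fun f => ?_⟩
  -- Invariance moves the constant term from `u` to the base point `i` of the orbit, where it is the
  -- value of the central character.
  · obtain ⟨w, hw⟩ := exists_smul_base u
    rw [← hinv w, constantCoeff_perm, hw, ← hp2, Finsupp.sum, Finset.sum_apply, map_sum]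
    refine Finset.sum_congr rfl fun α _ => ?_
    rw [Pi.smul_apply, MvPowerSeries.constantCoeff_smul, constantCoeff_monomialUnit, smul_eq_mul]
  · simp only [Finsupp.sum, map_sum, map_smul, LinearMap.sum_apply, LinearMap.smul_apply,
      heckeRep_laurentMonomial, LinearMap.mulLeft_apply, Finset.sum_mul, smul_mul_assoc]

/-- The generators act as multiplication by invariants without constant term, which raises the
filtration by one, and the remaining factors of the two-sided ideal preserve the filtration. -/
theorem heckeRep_idealI {x : Hecke q m} (hx : x ∈ idealI i) {n : ℕ} {f : PolyRep i}
    (hf : f ∈ invariantIdeal i ^ n) : heckeRep i x f ∈ invariantIdeal i ^ (n + 1) := by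
  induction hx using TwoSidedIdeal.span_induction generalizing f with
  | mem x hx =>
    obtain ⟨z, hz, h⟩ := heckeRep_centralKernel hx
    rw [h]
    exact mul_mem_invariantIdeal_pow hz hf
  | zero => simp
  | add x y _ _ hx hy => rw [map_add]; exact add_mem (hx hf) (hy hf)
  | neg x _ hx => rw [map_neg]; exact neg_mem (hx hf)
  | left_absorb a x _ hx =>
    rw [map_mul, Module.End.mul_apply]
    exact heckeRep_mem_invariantIdeal_pow a (hx hf)
  | right_absorb a x _ hx =>
    rw [map_mul, Module.End.mul_apply]
    exact hx (heckeRep_mem_invariantIdeal_pow a hf)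

theorem heckeRep_list_prod {l : List (Hecke q m)} (hl : ∀ y ∈ l, y ∈ idealI i) (f : PolyRep i) :
    heckeRep i l.prod f ∈ invariantIdeal i ^ l.length := by
  induction l with
  | nil => simp
  | cons y l ih =>
    rw [List.prod_cons, map_mul, Module.End.mul_apply]
    exact heckeRep_idealI (hl y List.mem_cons_self)
      (ih fun x hx => hl x (List.mem_cons_of_mem _ hx))

theorem heckeRep_idealPow {r : ℕ} {x : Hecke q m} (hx : x ∈ idealPow i r) (f : PolyRep i) :
    heckeRep i x f ∈ invariantIdeal i ^ r := by
  induction hx using TwoSidedIdeal.span_induction generalizing f with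
  | mem x hx =>
    obtain ⟨y, hy, rfl⟩ := hx
    have h := heckeRep_list_prod (l := List.ofFn y) (fun x hx => by
      obtain ⟨j, rfl⟩ := (List.mem_ofFn' _ _).1 hx
      exact hy j) f
    rwa [List.length_ofFn] at h
  | zero => simp
  | add x y _ _ hx hy => rw [map_add]; exact add_mem (hx f) (hy f)
  | neg x _ hx => rw [map_neg]; exact neg_mem (hx f)
  | left_absorb a x _ hx =>
    rw [map_mul, Module.End.mul_apply]
    exact heckeRep_mem_invariantIdeal_pow a (hx f)
  | right_absorb a x _ hx =>
    rw [map_mul, Module.End.mul_apply]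
    exact hx _

end Filtration

/-! ### The action of the completed algebra -/

section CompletedAction

variable {k : Type*} [Field k] {q : kˣ} {m : ℕ} {i : Fin (m + 1) → Residue q}

/-- The difference lies in the `r`-th power of the ideal, which maps into series of order at least
`r`. This makes the action of the completion independent of approximations. -/
theorem coeff_heckeRep_congr {r : ℕ} {h h' : Hecke q m} (hh : toQuo i r h = toQuo i r h')
    {α : Fin (m + 1) →₀ ℕ} (hα : α.degree < r) (f : PolyRep i) (u : Orb i) :
    MvPowerSeries.coeff α (heckeRep i h f u) = MvPowerSeries.coeff α (heckeRep i h' f u) := by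
  have h1 : h - h' ∈ idealPow i r := by
    rw [← TwoSidedIdeal.rel_iff]
    exact (RingCon.eq _).1 hh
  have h2 := le_order_of_mem_invariantIdeal_pow (heckeRep_idealPow h1 f) u
  have h3 := MvPowerSeries.coeff_of_lt_order (d := α) (lt_of_lt_of_le (by exact_mod_cast hα) h2)
  rw [map_sub, LinearMap.sub_apply, Pi.sub_apply, map_sub] at h3
  exact sub_eq_zero.1 h3

theorem coeff_hatAct {x : HeckeHat i} {r : ℕ} {h : Hecke q m} (hh : toQuo i r h = x.1 r)
    {α : Fin (m + 1) →₀ ℕ} (hα : α.degree < r) (f : PolyRep i) (u : Orb i) :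
    MvPowerSeries.coeff α (hatAct i x f u) = MvPowerSeries.coeff α (heckeRep i h f u) := by
  change MvPowerSeries.coeff α (heckeRep i (approx i (α.degree + 1) x) f u) = _
  obtain ⟨g, hg1, hg2⟩ := x.2 (α.degree + 1) r hα
  rw [coeff_heckeRep_congr ((toQuo_approx i _ x).trans hg1.symm) (Nat.lt_succ_self _),
    coeff_heckeRep_congr (hg2.trans hh.symm) hα]

theorem hatAct_toHat (h : Hecke q m) (f : PolyRep i) :
    hatAct i (toHat i h) f = heckeRep i h f := by
  funext u
  ext α
  exact coeff_hatAct (r := α.degree + 1) rfl (Nat.lt_succ_self _) f u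

theorem hatAct_zero_right (x : HeckeHat i) : hatAct i x 0 = 0 := by
  funext u
  ext α
  rw [coeff_hatAct (toQuo_approx i _ x) (Nat.lt_succ_self _), map_zero]

theorem hatAct_mul_toHat (x : HeckeHat i) (v : Hecke q m) (f : PolyRep i) :
    hatAct i (x * toHat i v) f = hatAct i x (heckeRep i v f) := by
  funext u
  ext α
  rw [coeff_hatAct (toQuo_approx i _ x) (Nat.lt_succ_self _), ← Module.End.mul_apply, ← map_mul]
  refine coeff_hatAct ?_ (Nat.lt_succ_self _) f u
  rw [map_mul, toQuo_approx]
  rfl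

/-- A coefficient of a product involves only coefficients of the factors of no larger degree, so a
single approximation of `x` computes both sides. -/
theorem hatAct_mul_of_invariant {z : PolyRep i} (hz : ∀ w, perm w z = z) (x : HeckeHat i)
    (f : PolyRep i) : hatAct i x (z * f) = z * hatAct i x f := by
  funext u
  ext α
  rw [coeff_hatAct (toQuo_approx i _ x) (Nat.lt_succ_self _), heckeRep_mul_of_invariant hz,
    Pi.mul_apply, Pi.mul_apply, MvPowerSeries.coeff_mul, MvPowerSeries.coeff_mul]
  refine Finset.sum_congr rfl fun p hp => ?_
  congr 1
  rw [coeff_hatAct (toQuo_approx i _ x)]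
  rw [← Finset.HasAntidiagonal.mem_antidiagonal.1 hp, map_add]
  omega

/-- The action on elements which become values of `v` after multiplication by an invariant
element. -/
theorem mul_hatAct {x : HeckeHat i} {v y : Hecke q m} (hx : x * toHat i v = toHat i y)
    {z : PolyRep i} (hz : ∀ w, perm w z = z) {f g : PolyRep i} (hf : z * f = heckeRep i v g) :
    z * hatAct i x f = heckeRep i y g := by
  rw [← hatAct_mul_of_invariant hz, hf, ← hatAct_mul_toHat, hx, hatAct_toHat]

end CompletedAction

/-! ### Inverting the symmetriser on fractions -/

section Denominators

variable {k : Type*} [Field k] {q : kˣ} {m : ℕ} {i : Fin (m + 1) → Residue q}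

theorem toFrac_ne_zero {z : PolyRep i} {u : Orb i} (h : z u ≠ 0) : toFrac z u ≠ 0 := by
  rw [toFrac_apply]
  exact (map_ne_zero_iff _ (IsFractionRing.injective (PS k m) (PSFrac k m))).2 h

/-- Divide the diagonal monomial of the Vandermonde determinant by the determinant: both the
determinant and its expansion transform by the sign. The constant `1 / n!` is not available in every
characteristic. -/
theorem exists_sum_permF_eq_one :
    ∃ e : FracRep i, ∑ w : Equiv.Perm (Fin (m + 1)), permF w e = 1 := by
  set V : FracRep i := (Matrix.vandermonde (XF i)).det with hV
  have hVne : ∀ u, V u ≠ 0 := by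
    intro u
    rw [hV, Matrix.det_vandermonde, Finset.prod_apply]
    refine Finset.prod_ne_zero_iff.2 fun a _ => ?_
    rw [Finset.prod_apply]
    exact Finset.prod_ne_zero_iff.2 fun b hb => XF_sub_ne a b (Finset.mem_Ioi.1 hb).ne u
  have hVsum : V = ∑ w : Equiv.Perm (Fin (m + 1)),
      Equiv.Perm.sign w • ∏ j, XF i (w j) ^ (j : ℕ) := by
    rw [hV, Matrix.det_apply]
    rfl
  have hVperm : ∀ w, permF w V = Equiv.Perm.sign w • V := by
    intro w
    have h := Matrix.det_permute w (Matrix.vandermonde (XF i))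
    rw [Units.smul_def, zsmul_eq_mul, hV, ← h, RingHom.map_det]
    congr 1
    ext a b
    simp only [RingHom.mapMatrix_apply, Matrix.map_apply, Matrix.vandermonde_apply, map_pow,
      permF_XF, Matrix.submatrix_apply, id]
  refine ⟨(∏ j, XF i j ^ (j : ℕ)) / V, ?_⟩
  have h1 : ∀ w : Equiv.Perm (Fin (m + 1)), permF w ((∏ j, XF i j ^ (j : ℕ)) / V) =
      (Equiv.Perm.sign w • ∏ j, XF i (w j) ^ (j : ℕ)) / V := by
    intro w
    rw [permF_div, hVperm, map_prod]
    simp only [map_pow, permF_XF]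
    funext u
    rcases Int.units_eq_one_or (Equiv.Perm.sign w) with h | h
    · simp [h]
    · simp [h, neg_div, div_neg]
  rw [Finset.sum_congr rfl fun w _ => h1 w]
  funext u
  have h2 := congrFun hVsum u
  simp only [Finset.sum_apply, Pi.div_apply] at h2 ⊢
  rw [← Finset.sum_div, ← h2, div_self (hVne u), Pi.one_apply]

/-- Summing the weight of the whole group over the inverses of the coset representatives leaves
exactly the sum over the subgroup, since `(d v)⁻¹ = v⁻¹ d⁻¹`. -/
theorem exists_sum_parabolic_permF_eq_one {α : Type*} [LinearOrder α] {φ : Fin (m + 1) → α}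
    (hφ : Monotone φ) :
    ∃ e : FracRep i, ∑ w ∈ parabolicFinset (steps φ), permF w e = 1 := by
  obtain ⟨e, he⟩ := exists_sum_permF_eq_one (i := i)
  refine ⟨∑ d ∈ cosetReps Finset.univ (steps φ), permF d⁻¹ e, ?_⟩
  have h1 := sum_cosetReps hφ (K := Finset.univ) (fun w _ => mem_parabolic_univ w)
    fun w => permF w⁻¹ e
  have h2 : ∑ w : Equiv.Perm (Fin (m + 1)), permF w⁻¹ e = 1 :=
    (Fintype.sum_equiv (Equiv.inv _) _ (fun w => permF w e) fun _ => rfl).trans he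
  rw [parabolicFinset_univ, h2, Finset.sum_comm] at h1
  rw [h1]
  refine Finset.sum_nbij' (fun w => w⁻¹) (fun w => w⁻¹) ?_ ?_ ?_ ?_ ?_
  · simp [mem_parabolicFinset]
  · simp [mem_parabolicFinset]
  · simp
  · simp
  · intro w _
    simp [map_sum, permF_permF]

theorem perm_one (f : PolyRep i) : perm 1 f = f := by
  funext u
  exact permPS_one (f u)

theorem perm_perm (w v : Equiv.Perm (Fin (m + 1))) (f : PolyRep i) :
    perm w (perm v f) = perm (w * v) f := by
  funext u
  simp only [perm_apply, permPS_mul, mul_inv_rev, mul_smul]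

/-- Every element without zero components divides such an element which is invariant. -/
theorem exists_invariant_multiple {b : PolyRep i} (hb : ∀ u, b u ≠ 0) :
    ∃ z y : PolyRep i, (∀ w, perm w z = z) ∧ (∀ u, z u ≠ 0) ∧ z = y * b := by
  classical
  refine ⟨∏ w, perm w b, ∏ w ∈ Finset.univ.erase 1, perm w b, fun w => ?_, fun u => ?_, ?_⟩
  · rw [map_prod]
    exact Fintype.prod_equiv (Equiv.mulLeft w) _ _ fun v => perm_perm w v b
  · rw [Finset.prod_apply]
    refine Finset.prod_ne_zero_iff.2 fun w _ => ?_
    rw [perm_apply]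
    exact (map_ne_zero_iff _ (permPS k w).injective).2 (hb _)
  · rw [← Finset.prod_erase_mul _ _ (Finset.mem_univ (1 : Equiv.Perm (Fin (m + 1)))), perm_one]

/-- Fractions have a common invariant denominator. -/
theorem exists_invariant_denominator (G : FracRep i) :
    ∃ z g : PolyRep i, (∀ w, perm w z = z) ∧ (∀ u, z u ≠ 0) ∧ toFrac z * G = toFrac g := by
  choose a b hb hab using fun u => IsFractionRing.div_surjective (A := PS k m) (G u)
  have hb0 : ∀ u, b u ≠ 0 := fun u => nonZeroDivisors.ne_zero (hb u)
  obtain ⟨z, y, hz, hz0, h1⟩ := exists_invariant_multiple hb0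
  refine ⟨z, y * a, hz, hz0, ?_⟩
  rw [h1, map_mul, map_mul, mul_assoc]
  congr 1
  funext u
  have h2 := toFrac_ne_zero (hb0 u)
  rw [Pi.mul_apply, ← hab, toFrac_apply]
  exact mul_div_cancel₀ _ h2

/-- Up to an invariant factor, invariant elements lie in the image of `v_J^♯`. -/
theorem exists_vHash_eq {α : Type*} [LinearOrder α] {φ : Fin (m + 1) → α} (hφ : Monotone φ)
    {f : PolyRep i} (hf : ∀ w ∈ parabolic (steps φ), perm w f = f) {e : FracRep i}
    (he : ∑ w ∈ parabolicFinset (steps φ), permF w e = 1) :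
    ∃ z g : PolyRep i, (∀ w, perm w z = z) ∧ (∀ u, z u ≠ 0) ∧
      thetaProd i φ * toFrac g = toFrac z * (e * toFrac f) ∧
      z * f = heckeRep i (vHash q (steps φ)) g := by
  -- With this `g` the weighted symmetrisation returns `z f`: the weight `Θ_J` cancels, `z` and `f`
  -- are invariant under the group, and the translates of `e` add up to one.
  obtain ⟨z, g, hz, hz0, hg⟩ := exists_invariant_denominator (e * toFrac f / thetaProd i φ)
  have hcancel : thetaProd i φ * toFrac g = toFrac z * (e * toFrac f) := by
    rw [← hg]
    funext u
    have := thetaProd_ne_zero (i := i) φ u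
    simp only [Pi.mul_apply, Pi.div_apply]
    field_simp
  refine ⟨z, g, hz, hz0, hcancel, toFrac_injective ?_⟩
  have h1 : ∀ w ∈ parabolicFinset (steps φ), permF w (toFrac z * (e * toFrac f)) =
      toFrac z * (permF w e * toFrac f) := by
    intro w hw
    rw [map_mul, map_mul, permF_toFrac w z, hz, permF_toFrac w f,
      hf w (mem_parabolicFinset.1 hw)]
  rw [toFrac_vHash hφ, hcancel, Finset.sum_congr rfl h1, ← Finset.mul_sum, ← Finset.sum_mul, he,
    one_mul, map_mul]

/-- For invariant `f` and weights `e` averaging to one, an element which sends `v_J^♯` to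
`v_I^♯` acts on `f` by a weighted symmetrisation. -/
theorem toFrac_hatAct {α : Type*} [LinearOrder α] {φ : Fin (m + 1) → α} (hφ : Monotone φ)
    {x : HeckeHat i}
    (hx : x * toHat i (vHash q (steps φ)) = toHat i (vHash q (Finset.univ : Finset (Fin m))))
    {f : PolyRep i} (hf : ∀ w ∈ parabolic (steps φ), perm w f = f) {e : FracRep i}
    (he : ∑ w ∈ parabolicFinset (steps φ), permF w e = 1) {θ : FracRep i}
    (hθ : thetaProd i (fun _ => ()) = θ * thetaProd i φ) :
    toFrac (hatAct i x f) = ∑ w, permF w (θ * e * toFrac f) := by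
  obtain ⟨z, g, hz, hz0, hcancel, h1⟩ := exists_vHash_eq hφ hf he
  have h2 := congrArg toFrac (mul_hatAct hx hz h1)
  rw [← steps_const, toFrac_vHash fun _ _ _ => le_rfl, steps_const, parabolicFinset_univ, hθ,
    mul_assoc, hcancel, map_mul] at h2
  have h3 : toFrac z * toFrac (hatAct i x f) =
      toFrac z * ∑ w, permF w (θ * e * toFrac f) := by
    rw [h2, Finset.mul_sum]
    refine Finset.sum_congr rfl fun w _ => ?_
    rw [show θ * (toFrac z * (e * toFrac f)) = toFrac z * (θ * e * toFrac f) by ring, map_mul,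
      permF_toFrac w z, hz]
  funext u
  exact mul_left_cancel₀ (toFrac_ne_zero (hz0 u)) (congrFun h3 u)

/-- The chosen multiplier for a zero component need not itself be zero. It kills the image of
`v_J^♯`, which contains `f` up to an invariant factor with no zero component. -/
theorem hatAct_eq_zero {α : Type*} [LinearOrder α] {φ : Fin (m + 1) → α} (hφ : Monotone φ)
    {x : HeckeHat i} (hx : x * toHat i (vHash q (steps φ)) = 0)
    {f : PolyRep i} (hf : ∀ w ∈ parabolic (steps φ), perm w f = f) : hatAct i x f = 0 := by
  obtain ⟨e, he⟩ := exists_sum_parabolic_permF_eq_one (i := i) hφ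
  obtain ⟨z, g, hz, hz0, -, h1⟩ := exists_vHash_eq hφ hf he
  have h2 := mul_hatAct (y := 0) (hx.trans (map_zero _).symm) hz h1
  rw [map_zero, LinearMap.zero_apply] at h2
  funext u
  exact (mul_eq_zero.1 (congrFun h2 u)).resolve_left (hz0 u)

/-- A pair `j < l` either straddles the cut at `a` or lies on one side of it. The straddling pairs
give the double product of the final formula. -/
theorem thetaProd_const (a : Fin m) : thetaProd i (fun _ => ()) =
    (∏ l ∈ Finset.Ioi a.castSucc, ∏ j ∈ Finset.Iic a.castSucc, theta i j l) *
      thetaProd i (side a) := by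
  rw [thetaProd, thetaProd, ← Finset.prod_filter_mul_prod_filter_not _
    fun p => side a p.1 ≠ side a p.2]
  congr 1
  · rw [Finset.prod_comm, ← Finset.prod_product']
    refine Finset.prod_congr ?_ fun _ _ => rfl
    ext ⟨j, l⟩
    simp only [side, Finset.mem_filter, Finset.mem_univ, and_true, true_and, ne_eq,
      decide_eq_decide, Finset.mem_product, Finset.mem_Iic, Finset.mem_Ioi]
    constructor
    · rintro ⟨h1, h2⟩
      by_cases h3 : a.castSucc < j
      · exact absurd ⟨fun _ => h3.trans h1, fun _ => h3⟩ h2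
      · refine ⟨not_lt.1 h3, ?_⟩
        by_contra h4
        exact h2 ⟨fun h => absurd h h3, fun h => absurd h h4⟩
    · rintro ⟨h1, h2⟩
      exact ⟨h1.trans_lt h2, fun h => h1.not_gt (h.2 h2)⟩
  · refine Finset.prod_congr ?_ fun _ _ => rfl
    ext ⟨j, l⟩
    simp

end Denominators

/-! ### The spaces of invariants -/

section Invariants

variable {k : Type*} [Field k] {q : kˣ} {m : ℕ} {i : Fin (m + 1) → Residue q}

theorem smul_eq_self_iff {w : Equiv.Perm (Fin (m + 1))} {u : Orb i} :
    w • u = u ↔ ∀ j, u.1 (w j) = u.1 j := by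
  rw [← inv_smul_eq_iff.trans eq_comm, Subtype.ext_iff, funext_iff]
  exact forall_congr' fun j => by rw [smul_apply, inv_inv]

theorem monotone_lex {α β : Type*} [LinearOrder α] [LinearOrder β] {φ : Fin (m + 1) → α}
    (hφ : Monotone φ) {ψ : Fin (m + 1) → β}
    (hψ : ∀ r ∈ steps φ, ψ r.castSucc ≤ ψ r.succ) : Monotone fun j => toLex (φ j, ψ j) := by
  rw [Fin.monotone_iff_le_succ]
  intro r
  rw [Prod.Lex.toLex_le_toLex]
  rcases (hφ (Fin.castSucc_lt_succ (i := r)).le).lt_or_eq with h | h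
  · exact Or.inl h
  · exact Or.inr ⟨h, hψ r (mem_steps.2 h)⟩

theorem steps_lex {α : Type*} [LinearOrder α] (φ : Fin (m + 1) → α) (u : Orb i) :
    steps (fun j => toLex (φ j, u.1 j)) = stab (steps φ) u := by
  ext r
  simp [mem_steps, stab]

/-- Because `u` increases weakly on each block, the pair `(φ, u)` is weakly increasing in the
lexicographic order, and preserving it means preserving both functions. -/
theorem mem_parabolic_stab {α : Type*} [LinearOrder α] {φ : Fin (m + 1) → α} (hφ : Monotone φ)
    {u : Orb i} (hu : u ∈ U (steps φ)) {w : Equiv.Perm (Fin (m + 1))} :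
    w ∈ parabolic (stab (steps φ) u) ↔ w ∈ parabolic (steps φ) ∧ w • u = u := by
  rw [← steps_lex, mem_parabolic_steps (monotone_lex hφ hu), mem_parabolic_steps hφ,
    smul_eq_self_iff, ← forall_and]
  exact forall_congr' fun j => by simp

/-- Distinct coset representatives move `u` to distinct points, so one summand survives; invariance
of `g` allows any other element of the same coset in its place. -/
theorem xi_apply_smul {α : Type*} [LinearOrder α] {φ : Fin (m + 1) → α} (hφ : Monotone φ)
    {u : Orb i} (hu : u ∈ U (steps φ)) {g : PS k m}
    (hg : ∀ w ∈ parabolic (stab (steps φ) u), permPS k w g = g) {w : Equiv.Perm (Fin (m + 1))}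
    (hw : w ∈ parabolic (steps φ)) : xi (steps φ) u g (w • u) = permPS k w g := by
  classical
  obtain ⟨d, hd, v, hv, rfl⟩ := exists_cosetRep
    (fun x hx => ((mem_parabolic_stab hφ hu).1 hx).1) hw
  rw [← permPS_mul, hg v hv, mul_smul, ((mem_parabolic_stab hφ hu).1 hv).2, xi,
    Finset.sum_apply, Finset.sum_eq_single_of_mem d hd, Pi.single_eq_same]
  intro d' hd' hne
  rw [Pi.single_eq_of_ne]
  intro h
  refine hne ?_
  rw [← steps_lex] at hd hd'
  refine cosetReps_eq (monotone_lex hφ hu) hd' hd ?_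
  rw [steps_lex, mem_parabolic_stab hφ hu, mul_smul, h, inv_smul_smul]
  exact ⟨mul_mem (inv_mem (mem_parabolic_of_mem_cosetReps hd'))
    (mem_parabolic_of_mem_cosetReps hd), rfl⟩

theorem xi_apply_eq_zero {J : Finset (Fin m)} {u v : Orb i}
    (hv : ∀ w ∈ parabolic J, w • u ≠ v) (g : PS k m) : xi J u g v = 0 := by
  classical
  rw [xi, Finset.sum_apply]
  refine Finset.sum_eq_zero fun d hd => Pi.single_eq_of_ne ?_ _
  exact (hv d (mem_parabolic_of_mem_cosetReps hd)).symm

theorem perm_xi {α : Type*} [LinearOrder α] {φ : Fin (m + 1) → α} (hφ : Monotone φ)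
    {u : Orb i} (hu : u ∈ U (steps φ)) {g : PS k m}
    (hg : ∀ w ∈ parabolic (stab (steps φ) u), permPS k w g = g) {w : Equiv.Perm (Fin (m + 1))}
    (hw : w ∈ parabolic (steps φ)) : perm w (xi (steps φ) u g) = xi (steps φ) u g := by
  funext v
  rw [perm_apply]
  by_cases h : ∃ x ∈ parabolic (steps φ), x • u = v
  · obtain ⟨x, hx, rfl⟩ := h
    rw [← mul_smul, xi_apply_smul hφ hu hg (mul_mem (inv_mem hw) hx), xi_apply_smul hφ hu hg hx,
      permPS_mul, mul_inv_cancel_left]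
  · push Not at h
    rw [xi_apply_eq_zero h, xi_apply_eq_zero, map_zero]
    intro x hx hxv
    exact h (w * x) (mul_mem hw hx) (by rw [mul_smul, hxv, smul_inv_smul])

theorem exists_smul_eq (u v : Orb i) : ∃ w : Equiv.Perm (Fin (m + 1)), w • u = v := by
  obtain ⟨x, hx⟩ := exists_smul_base u
  obtain ⟨y, hy⟩ := exists_smul_base v
  exact ⟨y * x⁻¹, by rw [mul_smul, hx, ← hy, smul_inv_smul]⟩

/-- The whole group acts transitively on the orbit, so an invariant element is recovered from its
component at `u`, itself invariant under the stabiliser. -/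
theorem mem_Rhat_univ {u : Orb i} (hu : u ∈ U (Finset.univ : Finset (Fin m))) {f : PolyRep i}
    (hf : ∀ w, perm w f = f) : f ∈ Rhat Finset.univ u := by
  have h1 : ∀ w, f (w • u) = permPS k w (f u) := by
    intro w
    conv_lhs => rw [← hf w]
    rw [perm_apply, inv_smul_smul]
  rw [← steps_const] at hu ⊢
  have hm : Monotone fun _ : Fin (m + 1) => () := fun _ _ _ => le_rfl
  have hg : ∀ w ∈ parabolic (stab (steps fun _ => ()) u), permPS k w (f u) = f u := by
    intro w hw
    rw [← h1, ((mem_parabolic_stab hm hu).1 hw).2]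
  refine ⟨f u, hg, ?_⟩
  funext v
  obtain ⟨w, rfl⟩ := exists_smul_eq u v
  rw [h1, xi_apply_smul hm hu hg]
  rw [steps_const]
  exact mem_parabolic_univ w

theorem single_mem_twistedRep {u : Orb i} (hu : u ∈ U (Finset.univ : Finset (Fin m)))
    {f : PolyRep i} (hf : ∀ w, perm w f = f) :
    (Pi.single Finset.univ f : Finset (Fin m) → PolyRep i) ∈ twistedRep i := by
  rw [twistedRep, Submodule.mem_pi]
  intro L _
  by_cases hL : L = Finset.univ
  · subst hL
    rw [Pi.single_eq_same]
    exact Submodule.subset_span (Set.mem_biUnion hu (mem_Rhat_univ hu hf))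
  · rw [Pi.single_eq_of_ne hL]
    exact zero_mem _

end Invariants

/-! ### Young subgroups -/

section Young

variable {m : ℕ} {α : Type*} [LinearOrder α]

theorem lowerSet_mem_iff {A : Finset (Fin (m + 1))} (hA : IsLowerSet (A : Set (Fin (m + 1))))
    (j : Fin (m + 1)) : j ∈ A ↔ (j : ℕ) < A.card := by
  constructor
  · intro hj
    have h := Finset.card_le_card (show Finset.Iic j ⊆ A from fun l hl =>
      hA (Finset.mem_Iic.1 hl) hj)
    rw [Fin.card_Iic] at h
    omega
  · intro hj
    by_contra hjA
    have h := Finset.card_le_card (show A ⊆ Finset.Iio j from fun l hl =>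
      Finset.mem_Iio.2 (lt_of_not_ge fun hjl => hjA (hA hjl hl)))
    rw [Fin.card_Iio] at h
    omega

theorem sum_card_fibres (φ : Fin (m + 1) → α) {l : List α} (hl : l.Nodup) :
    (l.map fun c => (Finset.univ.filter fun j => φ j = c).card).sum =
      (Finset.univ.filter fun j => φ j ∈ l).card := by
  induction l with
  | nil => simp
  | cons c l ih =>
    rw [List.nodup_cons] at hl
    rw [List.map_cons, List.sum_cons, ih hl.2, ← Finset.card_union_of_disjoint]
    · congr 1
      ext j
      simp
    · rw [Finset.disjoint_filter]
      rintro j _ rfl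
      exact hl.1

theorem mem_ofType {t : List ℕ} {r : Fin m} :
    r ∈ ofType t ↔ ∀ j, (t.take j).sum ≠ (r : ℕ) + 1 := by
  classical
  rw [ofType, Finset.mem_filter, and_iff_right (Finset.mem_univ _)]

/-- The Young subgroup of the type given by the cardinalities of the fibres of a weakly increasing
function. -/
theorem ofType_eq_steps {φ : Fin (m + 1) → α} (hφ : Monotone φ) {l : List α}
    (hl : l.Pairwise (· < ·)) (hmem : ∀ j, φ j ∈ l) :
    ofType (l.map fun c => (Finset.univ.filter fun j => φ j = c).card) = steps φ := by
  have hnd : l.Nodup := hl.imp fun h => h.ne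
  -- Partial sums of the type count the positions with values in a prefix of `l`; by monotonicity
  -- these positions form an initial segment, determined by its size.
  have hsum : ∀ p, ((l.map fun c => (Finset.univ.filter fun j => φ j = c).card).take p).sum =
      (Finset.univ.filter fun j => φ j ∈ l.take p).card := by
    intro p
    rw [← List.map_take]
    exact sum_card_fibres φ ((List.take_sublist p l).nodup hnd)
  have hlower : ∀ p, IsLowerSet ((Finset.univ.filter fun j => φ j ∈ l.take p :
      Finset (Fin (m + 1))) : Set (Fin (m + 1))) := by
    intro p a b hba ha
    simp only [Finset.mem_coe, Finset.mem_filter, Finset.mem_univ, true_and] at ha ⊢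
    have hb := hmem b
    rw [← List.take_append_drop p l, List.mem_append] at hb
    rcases hb with hb | hb
    · exact hb
    · rw [← List.take_append_drop p l, List.pairwise_append] at hl
      exact absurd (hφ hba) (hl.2.2 _ ha _ hb).not_ge
  ext r
  rw [mem_ofType, mem_steps]
  constructor
  · intro h
    by_contra hne
    have hlt : φ r.castSucc < φ r.succ := lt_of_le_of_ne (hφ Fin.castSucc_lt_succ.le) hne
    -- At a jump of `φ`, the prefix of `l` ending with the value before the jump has its partial sum
    -- exactly at the cut.
    obtain ⟨l₁, l₂, h12⟩ := List.append_of_mem (hmem r.castSucc)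
    have htake : l.take (l₁.length + 1) = l₁ ++ [φ r.castSucc] := by
      rw [h12, List.take_append]
      simp
    apply h (l₁.length + 1)
    rw [hsum]
    have h1 := lowerSet_mem_iff (hlower (l₁.length + 1)) r.castSucc
    have h2 := lowerSet_mem_iff (hlower (l₁.length + 1)) r.succ
    rw [Finset.mem_filter, and_iff_right (Finset.mem_univ _), htake] at h1 h2
    have h3 := h1.1 (by simp)
    have h4 : φ r.succ ∉ l₁ ++ [φ r.castSucc] := by
      intro h4
      rw [List.mem_append, List.mem_singleton] at h4
      rcases h4 with h4 | h4
      · rw [h12, List.pairwise_append] at hl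
        exact (hl.2.2 _ h4 _ List.mem_cons_self).not_gt hlt
      · exact hne h4.symm
    have h5 := (not_congr h2).1 h4
    rw [htake]
    rw [Fin.val_castSucc] at h3
    rw [Fin.val_succ] at h5
    omega
  · intro h p hp
    rw [hsum] at hp
    have h1 := lowerSet_mem_iff (hlower p) r.castSucc
    have h2 := lowerSet_mem_iff (hlower p) r.succ
    rw [Finset.mem_filter, and_iff_right (Finset.mem_univ _), hp, Fin.val_castSucc] at h1
    rw [Finset.mem_filter, and_iff_right (Finset.mem_univ _), hp, Fin.val_succ, ← h] at h2
    have h3 := h1.2 (Nat.lt_succ_self _)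
    exact absurd (h2.1 h3) (lt_irrefl _)

end Young

/-! ### Young types of the residue multiplicities -/

section Multiplicities

variable {k : Type*} [Field k] {q : kˣ} {m : ℕ} {i : Fin (m + 1) → Residue q}

theorem mem_entries (u : Orb i) (j : Fin (m + 1)) : u.1 j ∈ entries i := by
  obtain ⟨w, hw⟩ := u.2
  rw [entries, Finset.mem_sort, hw]
  exact Finset.mem_image_of_mem _ (Finset.mem_univ _)

theorem entries_pairwise : (entries i).Pairwise (· < ·) := (Finset.sortedLT_sort _).pairwise

theorem ofType_multiplicities {u : Orb i} (hu : Monotone u.1) :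
    ofType (multiplicities u) = steps u.1 :=
  ofType_eq_steps hu entries_pairwise (mem_entries u)

/-- The bijection `σ` matches the entries `c` on a given side of the cut in `u` with a fibre of the
lexicographic pair. Ordering by residue first and side second produces `a₁, b₁, a₂, b₂, …`; some of
these fibres may be empty. -/
theorem ofType_splitMultiplicities (a : Fin m) {u v : Orb i} {σ : Equiv.Perm (Fin (m + 1))}
    (hσ : σ • u = v) (hmono : Monotone fun j => toLex (v.1 j, side a (σ⁻¹ j))) :
    ofType (splitMultiplicities a u) = steps fun j => toLex (v.1 j, side a (σ⁻¹ j)) := by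
  have hcard : ∀ (c : Residue q) (b : Bool)
      [DecidablePred fun j => toLex (v.1 j, side a (σ⁻¹ j)) = toLex (c, b)],
      (Finset.univ.filter fun j => toLex (v.1 j, side a (σ⁻¹ j)) = toLex (c, b)).card =
        (Finset.univ.filter fun j => side a j = b ∧ u.1 j = c).card := by
    intro c b _
    refine Finset.card_nbij' (fun j => σ⁻¹ j) (fun j => σ j) ?_ ?_ ?_ ?_
    · intro j hj
      rw [Finset.mem_coe, Finset.mem_filter] at hj ⊢
      have h := hj.2
      rw [EmbeddingLike.apply_eq_iff_eq, Prod.mk.injEq, ← hσ, smul_apply] at h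
      exact ⟨Finset.mem_univ _, h.2, h.1⟩
    · intro j hj
      rw [Finset.mem_coe, Finset.mem_filter] at hj ⊢
      refine ⟨Finset.mem_univ _, ?_⟩
      rw [EmbeddingLike.apply_eq_iff_eq, Prod.mk.injEq, ← hσ, smul_apply]
      simpa using hj.2.symm
    · intro j _
      simp
    · intro j _
      simp
  rw [← ofType_eq_steps (l := (entries i).flatMap fun c => [toLex (c, false), toLex (c, true)])
    hmono]
  · congr 1
    rw [splitMultiplicities, List.map_flatMap]
    congr 1
    funext c
    simp only [List.map_cons, List.map_nil, hcard]
    simp [side]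
  · rw [List.pairwise_flatMap]
    refine ⟨fun c _ => ?_, entries_pairwise.imp fun h => ?_⟩
    · simp [Prod.Lex.toLex_lt_toLex]
    · intro x hx y hy
      simp only [List.mem_cons, List.not_mem_nil, or_false] at hx hy
      rcases hx with rfl | rfl <;> rcases hy with rfl | rfl <;>
        exact Prod.Lex.toLex_lt_toLex.2 (Or.inl h)
  · intro j
    rw [List.mem_flatMap]
    refine ⟨v.1 j, mem_entries v j, ?_⟩
    cases side a (σ⁻¹ j) <;> simp

/-- A permutation of minimal length sorting `u` does not exchange equal entries. -/
theorem monotone_lex_of_minimal {a : Fin m} {u v : Orb i} (hv : Monotone v.1)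
    {σ : Equiv.Perm (Fin (m + 1))} (hσ : σ • u = v)
    (hmin : ∀ w : Equiv.Perm (Fin (m + 1)), w • u = v → len σ ≤ len w) :
    Monotone fun j => toLex (v.1 j, side a (σ⁻¹ j)) := by
  refine monotone_lex hv fun r hr => side_monotone a (le_of_lt ?_)
  refine (apply_lt_or_gt σ⁻¹ r).resolve_right fun h => ?_
  -- At a descent of `σ⁻¹` between equal entries of `v`, the shorter permutation `s r * σ` would
  -- sort `u` as well.
  have h1 := hmin (s r * σ) (by
    rw [mul_smul, hσ, smul_eq_self_iff]
    exact apply_s_of_eq (mem_steps.1 hr))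
  have h2 := len_s_mul_of_gt h
  omega

end Multiplicities

/-! ### Restriction of the symmetrisation to the sorted sequence -/

section Localisation

variable {k : Type*} [Field k] {q : kˣ} {m : ℕ} {i : Fin (m + 1) → Residue q}

theorem permF_prod_theta {a : Fin m} {y : Equiv.Perm (Fin (m + 1))}
    (hy : ∀ j, side a (y j) = side a j) :
    permF y (∏ l ∈ Finset.Ioi a.castSucc, ∏ j ∈ Finset.Iic a.castSucc, theta i j l) =
      ∏ l ∈ Finset.Ioi a.castSucc, ∏ j ∈ Finset.Iic a.castSucc, theta i j l := by
  have h1 : ∀ j, a.castSucc < y j ↔ a.castSucc < j := fun j => by simpa [side] using hy j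
  have h2 : ∀ j, a.castSucc < y⁻¹ j ↔ a.castSucc < j := fun j => by simpa using (h1 (y⁻¹ j)).symm
  simp only [map_prod, permF_theta]
  refine Finset.prod_nbij' y (y⁻¹ : Equiv.Perm _) ?_ ?_ (by simp) (by simp) fun l _ =>
    Finset.prod_nbij' y (y⁻¹ : Equiv.Perm _) ?_ ?_ (by simp) (by simp) fun _ _ => rfl
  · simp [h1]
  · intro j hj
    rw [Finset.mem_Ioi] at hj ⊢
    exact (h2 j).2 hj
  · intro j hj
    rw [Finset.mem_Iic, ← not_lt] at hj ⊢
    exact fun h => hj ((h1 j).1 h)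
  · intro j hj
    rw [Finset.mem_Iic, ← not_lt] at hj ⊢
    exact fun h => hj ((h2 j).1 h)

/-- The component at the sorted sequence of a symmetrisation of an invariant element supported on
one orbit. -/
theorem sum_permF_apply_sorted {a : Fin m} {uJ uK : Orb i} (huK : Monotone uK.1)
    {σ : Equiv.Perm (Fin (m + 1))} (hσ : σ • uJ = uK)
    (hψ : Monotone fun j => toLex (uK.1 j, side a (σ⁻¹ j))) {F e : FracRep i}
    (hF : ∀ y ∈ parabolic (steps (side a)), permF y F = F)
    (hsupp : ∀ v, F v ≠ 0 → ∃ y ∈ parabolic (steps (side a)), y • uJ = v)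
    (he : ∑ y ∈ parabolicFinset (steps (side a)), permF y e = 1) :
    (∑ w, permF w (F * e)) uK =
      (∑ x ∈ cosetReps (steps uK.1) (steps fun j => toLex (uK.1 j, side a (σ⁻¹ j))),
        permF x (permF σ F)) uK := by
  have hside : ∀ {y}, y ∈ parabolic (steps (side a)) ↔ ∀ j, side a (y j) = side a j :=
    mem_parabolic_steps (side_monotone a)
  have hstab : ∀ {x}, x ∈ parabolic (steps uK.1) ↔ x • uK = uK := fun {x} =>
    (mem_parabolic_steps huK).trans smul_eq_self_iff.symm
  -- The Young subgroup of the split type is the intersection of the stabiliser of `uK` with `σ W_J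
  -- σ⁻¹`.
  have hlex : ∀ {v}, v ∈ parabolic (steps fun j => toLex (uK.1 j, side a (σ⁻¹ j))) ↔
      v ∈ parabolic (steps uK.1) ∧ σ⁻¹ * v * σ ∈ parabolic (steps (side a)) := by
    intro v
    rw [mem_parabolic_steps hψ, mem_parabolic_steps huK, hside]
    simp only [EmbeddingLike.apply_eq_iff_eq, Prod.mk.injEq, forall_and]
    refine and_congr_right fun _ => ⟨fun h j => by simpa using h (σ j), fun h j => ?_⟩
    simpa using h (σ⁻¹ j)
  -- Insert `1 = ∑ y(e)`; since `F` is `W_J`-invariant, `F · y(e) = y(F e)`.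
  have h1 : ∀ x, permF x (permF σ F) =
      ∑ y ∈ parabolicFinset (steps (side a)), permF (x * σ * y) (F * e) := by
    intro x
    conv_lhs => rw [permF_permF, ← mul_one F, ← he, Finset.mul_sum, map_sum]
    refine Finset.sum_congr rfl fun y hy => ?_
    rw [← permF_permF (x * σ) y, map_mul (permF y), hF y (mem_parabolicFinset.1 hy)]
  rw [Finset.sum_congr rfl fun x _ => h1 x, ← Finset.sum_product', Finset.sum_apply,
    Finset.sum_apply]
  symm
  -- The factorisation `w = x σ y` is unique once `x` is a minimal coset representative, and every
  -- other `w` contributes zero at `uK`.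
  refine Finset.sum_of_injOn (fun p => p.1 * σ * p.2) ?_ (fun _ _ => Finset.mem_coe.2
    (Finset.mem_univ _)) ?_ fun _ _ => rfl
  · rintro ⟨x, y⟩ h ⟨x', y'⟩ h' hxy
    rw [Finset.mem_coe, Finset.mem_product, mem_parabolicFinset] at h h'
    change x * σ * y = x' * σ * y' at hxy
    obtain rfl : x = x' := by
      refine cosetReps_eq hψ h.1 h'.1 (hlex.2 ⟨mul_mem (inv_mem
        (mem_parabolic_of_mem_cosetReps h.1)) (mem_parabolic_of_mem_cosetReps h'.1), ?_⟩)
      have hx' : x' = x * σ * y * y'⁻¹ * σ⁻¹ := by rw [hxy]; group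
      rw [show σ⁻¹ * (x⁻¹ * x') * σ = y * y'⁻¹ by rw [hx']; group]
      exact mul_mem h.2 (inv_mem h'.2)
    rw [mul_left_cancel hxy]
  · intro w _ hw
    by_contra hne
    apply hw
    have hFw : F (w⁻¹ • uK) ≠ 0 := by
      intro h0
      rw [permF_apply, Pi.mul_apply, h0, zero_mul, map_zero] at hne
      exact hne rfl
    obtain ⟨y, hy, hyu⟩ := hsupp _ hFw
    -- The support condition gives `w y • uJ = uK`, so `w y σ⁻¹` fixes `uK`; splitting off its coset
    -- representative exhibits `w` in the form `x σ y'`.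
    have hmem : w * y * σ⁻¹ ∈ parabolic (steps uK.1) := by
      rw [hstab, mul_smul, mul_smul, ← hσ, inv_smul_smul, hyu, hσ, smul_inv_smul]
    obtain ⟨x, hx, v, hv, hxv⟩ := exists_cosetRep (fun v hv => (hlex.1 hv).1) hmem
    refine ⟨(x, σ⁻¹ * v * σ * y⁻¹), ?_, ?_⟩
    · rw [Finset.mem_coe, Finset.mem_product, mem_parabolicFinset]
      exact ⟨hx, mul_mem (hlex.1 hv).2 (inv_mem hy)⟩
    · have hw' : w = x * v * σ * y⁻¹ := by rw [← hxv]; group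
      rw [hw']
      group

end Localisation

end

end AffineSchur

/-! ### The theorem on the merge element -/

open AffineSchur
theorem mainTheorem6 {k : Type*} [Field k] (q : kˣ) (hq : q ≠ 1) {m : ℕ}
    (i : Fin (m + 1) → Residue q) (a : Fin m) (uJ uK : Orb i)
    (huJ : uJ ∈ U (Finset.univ.erase a)) (huK : uK ∈ U Finset.univ)
    (σ : Equiv.Perm (Fin (m + 1)))
    (hσ : σ • uJ = uK ∧ ∀ w : Equiv.Perm (Fin (m + 1)), w • uJ = uK → len σ ≤ len w) :
    ∃ b : SchurHat i,
      (∀ b' : SchurHat i, IsBasisOne Finset.univ (Finset.univ.erase a) b' ↔ b' = b) ∧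
      ∀ f ∈ Rhat (Finset.univ.erase a) uJ,
        rho b (Pi.single (Finset.univ.erase a) f) ∈ twistedRep i ∧
        (fun L => toFrac (rho b (Pi.single (Finset.univ.erase a) f) L) uK) =
          Pi.single (Finset.univ : Finset (Fin m))
            (symmetrise (multiplicities uK) (splitMultiplicities a uJ)
              (permF σ
                ((∏ l ∈ Finset.Ioi a.castSucc, ∏ j ∈ Finset.Iic a.castSucc, theta i j l) *
                  toFrac f)) uK) := by
  obtain ⟨hσ1, hσ2⟩ := hσ
  rw [← steps_side] at huJ ⊢
  have hφ := side_monotone a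
  have huK' : Monotone uK.1 := Fin.monotone_iff_le_succ.2 fun r => huK r (Finset.mem_univ r)
  have hψ := monotone_lex_of_minimal (a := a) huK' hσ1 hσ2
  have hh : toHat i (hash q (∑ d ∈ cosetReps Finset.univ (steps (side a)), Tw q d)) *
      toHat i (vHash q (steps (side a))) = toHat i (vHash q Finset.univ) := by
    rw [← map_mul, ← vHash_univ_eq q hφ]
  obtain ⟨b, hb⟩ := exists_isBasisOne hh
  refine ⟨b, fun b' => ⟨fun h => h.unique hb, fun h => h ▸ hb⟩, ?_⟩
  rintro f ⟨g, hg, rfl⟩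
  set f := xi (steps (side a)) uJ g with hf
  have hfinv : ∀ w ∈ parabolic (steps (side a)), perm w f = f := fun w hw => perm_xi hφ huJ hg hw
  obtain ⟨e, he⟩ := exists_sum_parabolic_permF_eq_one (i := i) hφ
  have hrho : ∀ L, rho b (Pi.single (steps (side a)) f) L =
      hatAct i (coeffHat b L (steps (side a))) f := by
    intro L
    rw [rho, Finset.sum_eq_single_of_mem (steps (side a)) (Finset.mem_univ _), Pi.single_eq_same]
    intro J' _ hJ'
    rw [Pi.single_eq_of_ne hJ', hatAct_zero_right]
  -- Each component is computed through a chosen multiplier, so the vanishing for `L ≠ Finset.univ`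
  -- requires the invariance of `f`.
  have hsingle : rho b (Pi.single (steps (side a)) f) = Pi.single Finset.univ
      (hatAct i (coeffHat b Finset.univ (steps (side a))) f) := by
    funext L
    rw [hrho]
    by_cases hL : L = Finset.univ
    · subst hL
      rw [Pi.single_eq_same]
    · rw [Pi.single_eq_of_ne hL]
      refine hatAct_eq_zero hφ ?_ hfinv
      rw [hb.coeffHat_mul hh, if_neg hL]
  have hact := toFrac_hatAct hφ (by rw [hb.coeffHat_mul hh, if_pos rfl]) hfinv he
    (thetaProd_const a)
  -- The image is a sum over the whole group, and left translation permutes its terms.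
  have hinv : ∀ w, perm w (hatAct i (coeffHat b Finset.univ (steps (side a))) f) =
      hatAct i (coeffHat b Finset.univ (steps (side a))) f := by
    intro w
    apply toFrac_injective
    rw [← permF_toFrac, hact, map_sum]
    exact Fintype.sum_equiv (Equiv.mulLeft w) _ _ fun v => permF_permF w v _
  rw [hsingle]
  refine ⟨single_mem_twistedRep huK hinv, ?_⟩
  funext L
  by_cases hL : L = Finset.univ
  · subst hL
    rw [Pi.single_eq_same, Pi.single_eq_same, hact, symmetrise, ofType_multiplicities huK',
      ofType_splitMultiplicities a hσ1 hψ, ← sum_permF_apply_sorted huK' hσ1 hψ _ _ he]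
    · simp only [mul_right_comm]
    · intro y hy
      rw [map_mul, permF_prod_theta ((mem_parabolic_steps hφ).1 hy), permF_toFrac y f, hfinv y hy]
    · intro v hv
      by_contra! hc
      exact hv (by rw [Pi.mul_apply, toFrac_apply, hf, xi_apply_eq_zero hc, map_zero, mul_zero])
  · rw [Pi.single_eq_of_ne hL, Pi.single_eq_of_ne hL, map_zero]
    rfl
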